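/- Let $n\ge 1$, let $s\in(0,1)$, and let $\Omega\subset\mathbb{R}^n$ be a bounded open set with Lipschitz boundary. Write $\mathcal{C}\Omega:=\mathbb{R}^n\setminus\Omega$ and $Q(\Omega):=\mathbb{R}^{2n}\setminus(\mathcal{C}\Omega)^2$. Let $\mathcal{W}^s(\Omega)$ be the set of measurable functions $u\colon\mathbb{R}^n\to\mathbb{R}$ whose restriction to $\Omega$ belongs to $W^{s,1}(\Omega)$, that is, $u\in L^1(\Omega)$ and $$\int_\Omega\int_\Omega\frac{|u(x)-u(y)|}{|x-y|^{n+s}}\,dx\,dy<+\infty .$$ A function $u\in\mathcal{W}^s(\Omega)$ is called an $s$-minimal function in $\Omega$ if, for every $v\in\mathcal{W}^s(\Omega)$ with $u=v$ almost everywhere in $\mathcal{C}\Omega$, the following integral converges absolutely and satisfies $$\iint_{Q(\Omega)}\big(|u(x)-u(y)|-|v(x)-v(y)|\big)\,\frac{dx\,dy}{|x-y|^{n+s}}\le 0 .$$ For a measurable set $E\subset\mathbb{R}^n$ let $$\mathrm{Per}_s(E,\Omega):=\frac12\iint_{Q(\Omega)}\frac{|\chi_E(x)-\chi_E(y)|}{|x-y|^{n+s}}\,dx\,dy\in[0,+\infty].$$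 A measurable set $E$ is called an $s$-minimal set in $\Omega$ if $\mathrm{Per}_s(E,\Omega)<+\infty$ and $\mathrm{Per}_s(E,\Omega)\le\mathrm{Per}_s(F,\Omega)$ for every measurable $F\subset\mathbb{R}^n$ with $F\setminus\Omega=E\setminus\Omega$. Theorem. Let $u\in\mathcal{W}^s(\Omega)$. 1. If $u$ is an $s$-minimal function in $\Omega$, then for every $\lambda\in\mathbb{R}$ the set $\{u\ge\lambda\}$ is an $s$-minimal set in $\Omega$. 2. Conversely, if $\{u\ge\lambda\}$ is an $s$-minimal set in $\Omega$ for almost every $\lambda\in\mathbb{R}$, then $u$ is an $s$-minimal function in $\Omega$. -/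

import Mathlib

open MeasureTheory Filter Topology
open scoped ENNReal NNReal

noncomputable section

namespace FractionalMinimal

/-- Euclidean space `ℝⁿ`. -/
abbrev Eucl (n : ℕ) : Type := EuclideanSpace ℝ (Fin n)

/-- `Ω` has Lipschitz boundary: near each of its boundary points `p`, after a choice of an
"upward" unit direction `e`, the set `Ω` is the strict epigraph of a Lipschitz function `g`
defined on the hyperplane orthogonal to `e`. -/
def HasLipschitzBoundary {n : ℕ} (Ω : Set (Eucl n)) : Prop :=
  ∀ p ∈ frontier Ω, ∃ e : Eucl n, ‖e‖ = 1 ∧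
    ∃ (K : ℝ≥0) (g : ((Submodule.span ℝ {e})ᗮ : Submodule ℝ (Eucl n)) → ℝ), LipschitzWith K g ∧
      ∀ᶠ x in 𝓝 p,
        (x ∈ Ω ↔ g ((Submodule.span ℝ {e})ᗮ.orthogonalProjectionOnto x) < inner ℝ e x)

/-- `Q(Ω) = ℝ²ⁿ ∖ (𝒞Ω)²`, where `𝒞Ω` is the complement of `Ω`. -/
def Q {n : ℕ} (Ω : Set (Eucl n)) : Set (Eucl n × Eucl n) :=
  (Ωᶜ ×ˢ Ωᶜ)ᶜ

/-- The quotient `|u(x) - u(y)| / |x - y|^(n+s)`. -/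
def gagliardoQuotient {n : ℕ} (s : ℝ) (u : Eucl n → ℝ) (x y : Eucl n) : ℝ :=
  |u x - u y| / ‖x - y‖ ^ ((n : ℝ) + s)

/-- The Gagliardo seminorm `[u]_{W^{s,1}(Ω)}`, with values in `[0, ∞]`. -/
def gagliardoSeminorm {n : ℕ} (s : ℝ) (Ω : Set (Eucl n)) (u : Eucl n → ℝ) : ℝ≥0∞ :=
  ∫⁻ x in Ω, ∫⁻ y in Ω, ENNReal.ofReal (gagliardoQuotient s u x y)

/-- The space `𝒲^s(Ω)` of the (Lebesgue) measurable functions `u : ℝⁿ → ℝ` whose restriction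
to `Ω` belongs to `W^{s,1}(Ω)`. A function is Lebesgue measurable exactly when it is
`AEMeasurable` for `volume`, and a set exactly when it is a `NullMeasurableSet`. -/
def SobolevW {n : ℕ} (s : ℝ) (Ω : Set (Eucl n)) : Set (Eucl n → ℝ) :=
  {u | AEMeasurable u volume ∧ IntegrableOn u Ω volume ∧ gagliardoSeminorm s Ω u < ∞}

/-- `u` is an `s`-minimal function in `Ω`: it lies in `𝒲^s(Ω)`, and for every competitor
`v ∈ 𝒲^s(Ω)` with `u = v` almost everywhere outside `Ω`, the integral
`∬_{Q(Ω)} (|u(x) - u(y)| - |v(x) - v(y)|) / |x - y|^(n+s) dx dy` exists (as a Lebesgue integral)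
and is nonpositive. -/
def IsSMinimalFunction {n : ℕ} (s : ℝ) (Ω : Set (Eucl n)) (u : Eucl n → ℝ) : Prop :=
  u ∈ SobolevW s Ω ∧
    ∀ v ∈ SobolevW s Ω, (∀ᵐ x ∂(volume : Measure (Eucl n)), x ∉ Ω → u x = v x) →
      IntegrableOn
        (fun z : Eucl n × Eucl n => (|u z.1 - u z.2| - |v z.1 - v z.2|) /
          ‖z.1 - z.2‖ ^ ((n : ℝ) + s)) (Q Ω) volume ∧
      ∫ z in Q Ω, (|u z.1 - u z.2| - |v z.1 - v z.2|) / ‖z.1 - z.2‖ ^ ((n : ℝ) + s) ≤ 0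

/-- The `s`-fractional perimeter of `E` in `Ω`, with values in `[0, ∞]`. -/
def fracPer {n : ℕ} (s : ℝ) (E Ω : Set (Eucl n)) : ℝ≥0∞ :=
  (1 / 2) * ∫⁻ z in Q Ω, ENNReal.ofReal (gagliardoQuotient s (E.indicator 1) z.1 z.2)

/-- `E` is an `s`-minimal set in `Ω`: it is (Lebesgue) measurable, has finite `s`-perimeter
in `Ω`, and minimises the `s`-perimeter in `Ω` among the measurable sets that agree with `E`
outside `Ω`. -/
def IsSMinimalSet {n : ℕ} (s : ℝ) (Ω E : Set (Eucl n)) : Prop :=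
  NullMeasurableSet E volume ∧ fracPer s E Ω < ∞ ∧
    ∀ F : Set (Eucl n), NullMeasurableSet F volume → F \ Ω = E \ Ω →
      fracPer s E Ω ≤ fracPer s F Ω

end FractionalMinimal

end

/-! Sets to functions: since |a - b| is the integral over t of |χ_{t ≤ a} - χ_{t ≤ b}|, Fubini turns
the energy difference of u and v over Q(Ω) into an integral over t of perimeter differences of {t ≤
u} and {t ≤ v}. If almost every {t ≤ u} is minimal, almost every integrand is nonpositive
(`energy_difference_nonpos`).

Functions to sets: let w be a `ramp` of u of width ε below level t. Both u - εw and εw are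
nondecreasing functions of u, so |u(x) - u(y)| is exactly the sum of their oscillations
(`abs_sub_ramp`). Replace εw by εv, where v = χ_F in Ω and v = w outside. Minimality of u and the
triangle inequality give w at most the energy of v (`IsSMinimalFunction.energy_ramp_le`). As ε → 0,
Fatou for w and dominated convergence for v yield the perimeter inequality.

No decay of u outside Ω is assumed, so its energy over Q(Ω) may be infinite. Integrability comes
instead from the finite interaction of every W^{s,1}(Ω) function with the complement, a fractional
Hardy inequality (`lintegral_mul_kernel_compl_lt_top`), which needs no vanishing trace because s <
1. Near the boundary, N disjoint translates of a thin layer fit into a layer Λ = 3N + 2 times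
thicker, and the change of v under translation is paid for by the Gagliardo energy. Choosing N with
Λ^s < N makes the layer masses, weighted by height^(-s), contract up to a summable error. -/

namespace FractionalMinimal

/-! ### The kernel and its tails -/

/-- The kernel `‖w‖^(-(n+s))`, with values in `[0, ∞]`, equal to `0` at the origin if `n + s ≠ 0`. -/
noncomputable def kernel {n : ℕ} (s : ℝ) (w : Eucl n) : ℝ≥0∞ :=
  ENNReal.ofReal ((‖w‖ ^ ((n : ℝ) + s))⁻¹)

lemma measurable_kernel {n : ℕ} (s : ℝ) : Measurable (kernel (n := n) s) := by
  unfold kernel; fun_prop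

lemma kernel_neg {n : ℕ} (s : ℝ) (w : Eucl n) : kernel s (-w) = kernel s w := by
  simp [kernel]

lemma kernel_sub_comm {n : ℕ} (s : ℝ) (x y : Eucl n) : kernel s (x - y) = kernel s (y - x) := by
  rw [← kernel_neg, neg_sub]

lemma kernel_smul {n : ℕ} (s : ℝ) {d : ℝ} (hd : 0 < d) (w : Eucl n) :
    kernel s (d • w) = ENNReal.ofReal ((d ^ ((n : ℝ) + s))⁻¹) * kernel s w := by
  rw [kernel, kernel, ← ENNReal.ofReal_mul (by positivity), norm_smul, Real.norm_of_nonneg hd.le,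
    Real.mul_rpow hd.le (norm_nonneg _), mul_inv]

/-- Where ‖w‖ ≥ 1 one has 1 + ‖w‖ ≤ 2‖w‖, so the kernel is dominated by a multiple of (1 +
‖w‖)^(-(n+s)), integrable because n + s > n. -/
lemma setLIntegral_kernel_lt_top {n : ℕ} {s : ℝ} (hs : 0 < s) :
    ∫⁻ w in {w : Eucl n | 1 ≤ ‖w‖}, kernel s w < ∞ := by
  have hr : (0 : ℝ) < (n : ℝ) + s := by positivity
  have hfin : ∫⁻ w : Eucl n, ENNReal.ofReal ((1 + ‖w‖) ^ (-((n : ℝ) + s))) < ∞ :=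
    finite_integral_one_add_norm (by simp [hs])
  calc ∫⁻ w in {w : Eucl n | 1 ≤ ‖w‖}, kernel s w
      ≤ ∫⁻ w in {w : Eucl n | 1 ≤ ‖w‖},
          ENNReal.ofReal (2 ^ ((n : ℝ) + s)) * ENNReal.ofReal ((1 + ‖w‖) ^ (-((n : ℝ) + s))) := by
        refine setLIntegral_mono' (measurableSet_le measurable_const measurable_norm) ?_
        intro w hw
        have hw : 1 ≤ ‖w‖ := hw
        rw [kernel, ← ENNReal.ofReal_mul (by positivity)]
        apply ENNReal.ofReal_le_ofReal
        rw [Real.rpow_neg (by positivity), ← div_eq_mul_inv, inv_eq_one_div,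
          div_le_div_iff₀ (by positivity) (by positivity), one_mul,
          ← Real.mul_rpow (by positivity) (by positivity)]
        exact Real.rpow_le_rpow (by positivity) (by linarith) hr.le
    _ ≤ ∫⁻ w, ENNReal.ofReal (2 ^ ((n : ℝ) + s)) *
          ENNReal.ofReal ((1 + ‖w‖) ^ (-((n : ℝ) + s))) := setLIntegral_le_lintegral _ _
    _ < ∞ := by
        rw [lintegral_const_mul' _ _ ENNReal.ofReal_ne_top]
        exact ENNReal.mul_lt_top ENNReal.ofReal_lt_top hfin

/-- Homogeneity of the tails of the kernel. -/
lemma setLIntegral_kernel_tail {n : ℕ} (s : ℝ) {d : ℝ} (hd : 0 < d) :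
    ∫⁻ w in {w : Eucl n | d ≤ ‖w‖}, kernel s w =
      ENNReal.ofReal (d ^ (-s)) * ∫⁻ w in {w : Eucl n | 1 ≤ ‖w‖}, kernel s w := by
  have hm (c : ℝ) : MeasurableSet {w : Eucl n | c ≤ ‖w‖} :=
    measurableSet_le measurable_const measurable_norm
  -- Change of variables w ↦ d • w: the Jacobian d^n and the homogeneity factor d^(-(n+s)) combine
  -- to d^(-s).
  have hmap := lintegral_map (μ := (volume : Measure (Eucl n)))
    ((measurable_kernel (n := n) s).indicator (hm d)) (measurable_const_smul d)
  rw [Measure.map_addHaar_smul _ hd.ne', lintegral_smul_measure, lintegral_indicator (hm d)] at hmap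
  have hcomp (w : Eucl n) : {w : Eucl n | d ≤ ‖w‖}.indicator (kernel s) (d • w) =
      ENNReal.ofReal ((d ^ ((n : ℝ) + s))⁻¹) * {w : Eucl n | 1 ≤ ‖w‖}.indicator (kernel s) w := by
    have : d • w ∈ {w : Eucl n | d ≤ ‖w‖} ↔ w ∈ {w : Eucl n | 1 ≤ ‖w‖} := by
      simp only [Set.mem_ofPred_eq, norm_smul, Real.norm_of_nonneg hd.le]
      exact le_mul_iff_one_le_right hd
    by_cases hw : w ∈ {w : Eucl n | 1 ≤ ‖w‖}
    · rw [Set.indicator_of_mem hw, Set.indicator_of_mem (this.2 hw), kernel_smul s hd]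
    · rw [Set.indicator_of_notMem hw, Set.indicator_of_notMem (mt this.1 hw), mul_zero]
  simp_rw [hcomp] at hmap
  rw [lintegral_const_mul' _ _ ENNReal.ofReal_ne_top, lintegral_indicator (hm 1)] at hmap
  have hdn : 0 < d ^ n := by positivity
  have key := congrArg (fun a => ENNReal.ofReal (d ^ n) * a) hmap
  simp only [smul_eq_mul, finrank_euclideanSpace, Fintype.card_fin] at key
  rw [← mul_assoc, ← mul_assoc, ← ENNReal.ofReal_mul hdn.le, ← ENNReal.ofReal_mul hdn.le,
    abs_of_pos (by positivity), mul_inv_cancel₀ hdn.ne', ENNReal.ofReal_one, one_mul] at key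
  rw [key]
  congr 2
  rw [Real.rpow_add hd, Real.rpow_natCast, mul_inv, ← mul_assoc, mul_inv_cancel₀ hdn.ne', one_mul,
    Real.rpow_neg hd.le]

/-- If the complement of `Ω` keeps distance `d` from `x`, the kernel centred at `x` has mass at
most `C d^(-s)` on it. -/
lemma setLIntegral_kernel_compl_le {n : ℕ} (s : ℝ) {S : Set (Eucl n)} {d : ℝ} (hd : 0 < d)
    {x : Eucl n} (hx : ∀ y ∈ S, d ≤ ‖x - y‖) :
    ∫⁻ y in S, kernel s (x - y) ≤
      ENNReal.ofReal (d ^ (-s)) * ∫⁻ w in {w : Eucl n | 1 ≤ ‖w‖}, kernel s w := by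
  rw [← setLIntegral_kernel_tail s hd]
  have hm : MeasurableSet {w : Eucl n | d ≤ ‖w‖} :=
    measurableSet_le measurable_const measurable_norm
  calc ∫⁻ y in S, kernel s (x - y) ≤ ∫⁻ y in {y | d ≤ ‖x - y‖}, kernel s (x - y) :=
        lintegral_mono_set hx
    _ = ∫⁻ y, {w : Eucl n | d ≤ ‖w‖}.indicator (kernel s) (x - y) := by
        rw [← lintegral_indicator (measurableSet_le measurable_const (by fun_prop))]
        rfl
    _ = _ := by rw [lintegral_sub_left_eq_self _ x, lintegral_indicator hm]

/-! ### Comparison of boundary layers by translation -/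

/-- One step of the layer comparison, for a fixed perturbation `σ` of the vertical direction. -/
lemma layer_translate_le {n : ℕ} {h : Eucl n → ℝ} {L : ℝ≥0} (hL : LipschitzWith L h)
    {e : Eucl n} (he : ‖e‖ = 1) (hadd : ∀ x t, h (x + t • e) = h x + t) (N : ℕ)
    {r : ℝ} (hr : 0 < r) {T T' : Set (Eucl n)} (hT : MeasurableSet T)
    (hTh : ∀ x ∈ T, 0 < h x ∧ h x < r)
    (hTT' : ∀ x ∈ T, ∀ w : Eucl n, ‖w‖ < (3 * N + 2) * r → 0 < h (x + w) →
      h (x + w) < (3 * N + 2) * r → x + w ∈ T')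
    {v : Eucl n → ℝ} (hv : Measurable v) {σ : Eucl n} (hσ : L * ‖σ‖ < r) (hσ' : ‖σ‖ < r) :
    N * ∫⁻ x in T, ‖v x‖ₑ ≤ (∫⁻ x in T', ‖v x‖ₑ) +
      ∑ j ∈ Finset.range N,
        ∫⁻ x in T, ‖v x - v (x + ((3 * (j + 1) * r) • e + σ))‖ₑ := by
  set τ : ℕ → Eucl n := fun j => ((3 * ((j : ℝ) + 1) * r) • e + σ) with hτ
  have hheight (j : ℕ) (x : Eucl n) : |h (x + τ j) - h x - 3 * (j + 1) * r| < r := by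
    have h1 := hL.dist_le_mul (x + (3 * ((j : ℝ) + 1) * r) • e + σ) (x + (3 * ((j : ℝ) + 1) * r) • e)
    rw [Real.dist_eq, dist_eq_norm, add_sub_cancel_left, hadd] at h1
    rw [hτ, ← add_assoc]
    calc _ = _ := by congr 1; ring
      _ ≤ _ := h1
      _ < r := hσ
  -- Translation by `τ j` puts T at heights strictly between (3j + 2)r and (3j + 5)r. These bands
  -- are disjoint and end at (3N + 2)r, so all N translates fit disjointly into T'.
  have hsum : ∑ j ∈ Finset.range N, ∫⁻ x in T, ‖v (x + τ j)‖ₑ ≤ ∫⁻ x in T', ‖v x‖ₑ := by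
    have hset (j : ℕ) : ∫⁻ x in T, ‖v (x + τ j)‖ₑ =
        ∫⁻ y in (fun y => y - τ j) ⁻¹' T, ‖v y‖ₑ := by
      rw [← lintegral_indicator hT, ← lintegral_indicator (hT.preimage (by fun_prop)),
        ← lintegral_add_right_eq_self (((fun y => y - τ j) ⁻¹' T).indicator _) (τ j)]
      congr 1 with x
      have hmem : x + τ j ∈ (fun y => y - τ j) ⁻¹' T ↔ x ∈ T := by
        rw [Set.mem_preimage, add_sub_cancel_right]
      by_cases hx : x ∈ T
      · rw [Set.indicator_of_mem hx, Set.indicator_of_mem (hmem.2 hx)]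
      · rw [Set.indicator_of_notMem hx, Set.indicator_of_notMem (mt hmem.1 hx)]
    simp_rw [hset]
    rw [← lintegral_biUnion_finset]
    · apply lintegral_mono_set
      intro y hy
      simp only [Set.mem_iUnion, Finset.mem_range, Set.mem_preimage] at hy
      obtain ⟨j, hj, hy⟩ := hy
      have h1 := abs_lt.1 (hheight j (y - τ j))
      have h2 := hTh _ hy
      have hj' : (j : ℝ) + 1 ≤ N := by exact_mod_cast hj
      have hjr : ((j : ℝ) + 1) * r ≤ N * r := by gcongr
      have hjr' : 0 ≤ (j : ℝ) * r := by positivity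
      rw [sub_add_cancel] at h1
      have := hTT' _ hy (τ j) ?_ ?_ ?_
      · rwa [sub_add_cancel] at this
      · calc ‖τ j‖ ≤ ‖(3 * ((j : ℝ) + 1) * r) • e‖ + ‖σ‖ := norm_add_le _ _
          _ = 3 * ((j : ℝ) + 1) * r + ‖σ‖ := by
            rw [norm_smul, he, mul_one, Real.norm_of_nonneg (by positivity)]
          _ < _ := by linarith
      · rw [sub_add_cancel]; linarith
      · rw [sub_add_cancel]; linarith
    · intro i _ j _ hij
      refine Set.disjoint_left.2 fun y hi hj => hij ?_
      have h1 := abs_lt.1 (hheight i (y - τ i))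
      have h2 := abs_lt.1 (hheight j (y - τ j))
      have h3 := hTh _ hi
      have h4 := hTh _ hj
      rw [sub_add_cancel] at h1 h2
      have h5 : ((i : ℝ) * r) < (j + 1) * r := by linarith
      have h6 : ((j : ℝ) * r) < (i + 1) * r := by linarith
      have h7 := lt_of_mul_lt_mul_right h5 hr.le
      have h8 := lt_of_mul_lt_mul_right h6 hr.le
      norm_cast at h7 h8
      omega
    · exact fun j _ => hT.preimage (by fun_prop)
  calc N * ∫⁻ x in T, ‖v x‖ₑ = ∑ j ∈ Finset.range N, ∫⁻ x in T, ‖v x‖ₑ := by simp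
    _ ≤ ∑ j ∈ Finset.range N, ((∫⁻ x in T, ‖v (x + τ j)‖ₑ) +
          ∫⁻ x in T, ‖v x - v (x + τ j)‖ₑ) := by
        refine Finset.sum_le_sum fun j _ => ?_
        rw [← lintegral_add_left (by fun_prop)]
        refine lintegral_mono fun x => ?_
        calc ‖v x‖ₑ = ‖v (x + τ j) + (v x - v (x + τ j))‖ₑ := by congr 1; ring
          _ ≤ _ := enorm_add_le _ _
    _ ≤ _ := by
        rw [Finset.sum_add_distrib]
        exact add_le_add_left hsum _

/-- One step of the layer comparison, averaged over the perturbations of the vertical direction. -/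
lemma layer_step {n : ℕ} {s : ℝ} (hs : 0 < s) {h : Eucl n → ℝ} {L : ℝ≥0} (hL1 : 1 ≤ L)
    (hL : LipschitzWith L h)
    {e : Eucl n} (he : ‖e‖ = 1) (hadd : ∀ x t, h (x + t • e) = h x + t) (N : ℕ)
    {r : ℝ} (hr : 0 < r) {T T' : Set (Eucl n)} (hT : MeasurableSet T)
    (hT' : MeasurableSet T') (hTh : ∀ x ∈ T, 0 < h x ∧ h x < r)
    (hTT' : ∀ x ∈ T, ∀ w : Eucl n, ‖w‖ < (3 * N + 2) * r → 0 < h (x + w) →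
      h (x + w) < (3 * N + 2) * r → x + w ∈ T')
    {v : Eucl n → ℝ} (hv : Measurable v) :
    N * (∫⁻ x in T, ‖v x‖ₑ) *
        (ENNReal.ofReal (r ^ n) * volume (Metric.ball (0 : Eucl n) (L⁻¹ : ℝ))) ≤
      (∫⁻ x in T', ‖v x‖ₑ) *
        (ENNReal.ofReal (r ^ n) * volume (Metric.ball (0 : Eucl n) (L⁻¹ : ℝ))) +
      N * (ENNReal.ofReal (((3 * N + 2) * r) ^ ((n : ℝ) + s)) *
        ∫⁻ z in {z : Eucl n × Eucl n | z.1 ∈ T ∧ z.2 ∈ T' ∧ 2 * r < h z.2 - h z.1 ∧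
          h z.2 - h z.1 < (3 * N + 2) * r}, ‖v z.1 - v z.2‖ₑ * kernel s (z.1 - z.2)) := by
  have hL0 : (0 : ℝ) < L := lt_of_lt_of_le one_pos (by exact_mod_cast hL1)
  have hL1' : (1 : ℝ) ≤ L := by exact_mod_cast hL1
  have hh : Measurable h := hL.continuous.measurable
  set P : Set (Eucl n × Eucl n) := {z | z.1 ∈ T ∧ z.2 ∈ T' ∧ 2 * r < h z.2 - h z.1 ∧
          h z.2 - h z.1 < (3 * N + 2) * r} with hP
  have hP1 : MeasurableSet {z : Eucl n × Eucl n | 2 * r < h z.2 - h z.1} :=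
    measurableSet_lt measurable_const (by fun_prop)
  have hP2 : MeasurableSet {z : Eucl n × Eucl n | h z.2 - h z.1 < (3 * N + 2) * r} :=
    measurableSet_lt (by fun_prop) measurable_const
  have hPm : MeasurableSet P :=
    (hT.preimage measurable_fst).inter ((hT'.preimage measurable_snd).inter (hP1.inter hP2))
  have hk := measurable_kernel (n := n) s
  -- With radius r / L, a perturbation changes the height by less than r; L ≥ 1 makes its norm less
  -- than r as well.
  set B := Metric.ball (0 : Eucl n) (r * (L⁻¹ : ℝ)) with hB
  have hvolB : volume B =
      ENNReal.ofReal (r ^ n) * volume (Metric.ball (0 : Eucl n) (L⁻¹ : ℝ)) := by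
    rw [hB, Measure.addHaar_ball_mul_of_pos _ _ hr, finrank_euclideanSpace, Fintype.card_fin]
  rw [← hvolB]
  have hBσ : ∀ σ ∈ B, L * ‖σ‖ < r ∧ ‖σ‖ < r := by
    intro σ hσ
    rw [hB, mem_ball_zero_iff, ← div_eq_mul_inv, lt_div_iff₀ hL0] at hσ
    have := norm_nonneg σ
    constructor <;> nlinarith
  have hterm (j : ℕ) (hj : j ∈ Finset.range N) :
      ∫⁻ σ in B, ∫⁻ x in T, ‖v x - v (x + ((3 * ((j : ℝ) + 1) * r) • e + σ))‖ₑ ≤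
        ENNReal.ofReal (((3 * N + 2) * r) ^ ((n : ℝ) + s)) *
          ∫⁻ z in P, ‖v z.1 - v z.2‖ₑ * kernel s (z.1 - z.2) := by
    set a : ℝ := 3 * ((j : ℝ) + 1) * r with ha
    have hj' : (j : ℝ) + 1 ≤ N := by exact_mod_cast Finset.mem_range.1 hj
    have har : a + 2 * r ≤ (3 * N + 2) * r := by
      rw [ha]
      nlinarith [mul_le_mul_of_nonneg_right hj' hr.le]
    have har' : 3 * r ≤ a := by
      rw [ha]
      nlinarith [mul_nonneg (Nat.cast_nonneg (α := ℝ) j) hr.le]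
    set C := ENNReal.ofReal (((3 * N + 2) * r) ^ ((n : ℝ) + s)) with hC
    set g : Eucl n × Eucl n → ℝ≥0∞ := fun z => ‖v z.1 - v z.2‖ₑ * kernel s (z.1 - z.2) with hg
    have hgm : Measurable g := by fun_prop
    rw [← lintegral_indicator hPm, ← lintegral_const_mul' _ _ ENNReal.ofReal_ne_top,
      Measure.volume_eq_prod, lintegral_prod _ ((hgm.indicator hPm).const_mul _).aemeasurable,
      lintegral_lintegral_swap (by fun_prop)]
    refine (setLIntegral_mono' hT fun x hx => ?_).trans (setLIntegral_le_lintegral T _)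
    -- Substitute y = x + a • e + σ: averaging over σ turns single translations into a double
    -- integral over pairs (x, y).
    rw [← lintegral_add_left_eq_self (fun y => C * P.indicator g (x, y)) (x + a • e)]
    refine (setLIntegral_mono' Metric.isOpen_ball.measurableSet fun σ hσ => ?_).trans
      (setLIntegral_le_lintegral B _)
    obtain ⟨h1, h2⟩ := hBσ σ hσ
    obtain ⟨h3, h4⟩ := hTh x hx
    rw [← add_assoc]
    have h5 := hL.dist_le_mul (x + a • e + σ) (x + a • e)
    rw [Real.dist_eq, dist_eq_norm, add_sub_cancel_left, hadd] at h5
    have h6 := abs_lt.1 (h5.trans_lt h1)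
    have hnorm : ‖a • e‖ = a := by
      rw [norm_smul, he, mul_one, Real.norm_of_nonneg (by linarith)]
    have h7 : ‖a • e + σ‖ < (3 * N + 2) * r := by
      linarith [norm_add_le (a • e) σ]
    have h8 : 0 < ‖a • e + σ‖ := by
      have := norm_sub_le (a • e + σ) σ
      rw [add_sub_cancel_right, hnorm] at this
      linarith
    have hmem : (x, x + a • e + σ) ∈ P := by
      refine ⟨hx, ?_, ?_, ?_⟩
      · change x + a • e + σ ∈ T'
        rw [add_assoc]
        refine hTT' x hx _ h7 ?_ ?_ <;> rw [← add_assoc]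
        · linarith
        · linarith
      all_goals simp only
      · linarith
      · linarith
    rw [Set.indicator_of_mem hmem, hg]
    simp only
    -- The two points are less than (3N + 2)r apart, so the constant times the kernel is at least 1.
    rw [mul_left_comm]
    refine le_mul_of_one_le_right' ?_
    rw [kernel, hC, ← ENNReal.ofReal_mul (by positivity), ENNReal.one_le_ofReal, ← div_eq_mul_inv,
      add_assoc, ← norm_neg, neg_sub, add_sub_cancel_left,
      one_le_div (Real.rpow_pos_of_pos h8 _)]
    exact Real.rpow_le_rpow h8.le h7.le (by positivity)
  calc N * (∫⁻ x in T, ‖v x‖ₑ) * volume B = ∫⁻ σ in B, N * ∫⁻ x in T, ‖v x‖ₑ := by simp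
    _ ≤ ∫⁻ σ in B, ((∫⁻ x in T', ‖v x‖ₑ) + ∑ j ∈ Finset.range N,
        ∫⁻ x in T, ‖v x - v (x + ((3 * ((j : ℝ) + 1) * r) • e + σ))‖ₑ) :=
      setLIntegral_mono' Metric.isOpen_ball.measurableSet fun σ hσ =>
        layer_translate_le hL he hadd N hr hT hTh hTT' hv (hBσ σ hσ).1 (hBσ σ hσ).2
    _ = (∫⁻ x in T', ‖v x‖ₑ) * volume B + ∑ j ∈ Finset.range N, ∫⁻ σ in B,
        ∫⁻ x in T, ‖v x - v (x + ((3 * ((j : ℝ) + 1) * r) • e + σ))‖ₑ := by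
      rw [lintegral_add_left measurable_const, setLIntegral_const, lintegral_finsetSum]
      intro j _
      exact Measurable.lintegral_prod_right' (f := fun z : Eucl n × Eucl n =>
        ‖v z.2 - v (z.2 + ((3 * ((j : ℝ) + 1) * r) • e + z.1))‖ₑ) (by fun_prop)
    _ ≤ _ := by
      gcongr
      refine (Finset.sum_le_sum hterm).trans_eq ?_
      simp

/-! ### Fractional Hardy inequality -/

/-- A sequence that contracts up to a summable error is summable. -/
lemma tsum_lt_top_of_mul_succ_le {a e : ℕ → ℝ≥0∞} {M N : ℝ≥0} (hMN : M < N)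
    (ha : a 0 ≠ ∞) (he : ∑' k, e k ≠ ∞) (h : ∀ k, N * a (k + 1) ≤ M * a k + e k) :
    ∑' k, a k < ∞ := by
  have hN : 0 < N := lt_of_le_of_lt zero_le hMN
  obtain ⟨c, hc⟩ : ∃ c : ℝ≥0, N * a 0 + ∑' k, e k = c :=
    ⟨_, (ENNReal.coe_toNNReal (by finiteness)).symm⟩
  -- B is the fixed point of S ↦ (c + M S) / N, hence an invariant upper bound for the partial sums.
  set B : ℝ≥0 := c / (N - M)
  have hB : c + M * B = N * B := by
    have h1 : B * (N - M) = c := div_mul_cancel₀ _ (tsub_pos_of_lt hMN).ne'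
    have h2 : N = (N - M) + M := (tsub_add_cancel_of_le hMN.le).symm
    calc c + M * B = B * (N - M) + M * B := by rw [h1]
      _ = ((N - M) + M) * B := by ring
      _ = N * B := by rw [← h2]
  have hbound (K : ℕ) : ∑ k ∈ Finset.range K, a k ≤ B := by
    induction K with
    | zero => simp
    | succ K ih =>
      have hN' : (N : ℝ≥0∞) ≠ 0 := by exact_mod_cast hN.ne'
      rw [← ENNReal.mul_le_mul_iff_right hN' ENNReal.coe_ne_top]
      calc (N : ℝ≥0∞) * ∑ k ∈ Finset.range (K + 1), a k
          = (∑ k ∈ Finset.range K, N * a (k + 1)) + N * a 0 := by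
            rw [Finset.sum_range_succ', mul_add, Finset.mul_sum]
        _ ≤ (∑ k ∈ Finset.range K, (M * a k + e k)) + N * a 0 := by
            gcongr with k _; exact h k
        _ = M * (∑ k ∈ Finset.range K, a k) + (N * a 0 + ∑ k ∈ Finset.range K, e k) := by
            rw [Finset.sum_add_distrib, ← Finset.mul_sum]; ring
        _ ≤ M * B + (N * a 0 + ∑' k, e k) := by
            gcongr
            exact ENNReal.sum_le_tsum _
        _ = N * B := by
            rw [hc, add_comm]; exact_mod_cast hB
  exact (ENNReal.tsum_le_of_sum_range_le hbound).trans_lt ENNReal.coe_lt_top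

/-- Sublinear growth of the power s. This is where s < 1 enters the Hardy inequality. -/
lemma exists_nat_rpow_lt {s : ℝ} (hs0 : 0 < s) (hs1 : s < 1) :
    ∃ N : ℕ, (3 * (N : ℝ) + 2) ^ s < N := by
  have h := ((tendsto_rpow_atTop (sub_pos.2 hs1)).comp tendsto_natCast_atTop_atTop)
  obtain ⟨N, hN, hN2⟩ := ((h.eventually_gt_atTop ((5 : ℝ) ^ s)).and
    (eventually_ge_atTop 1)).exists
  have hN2 : (1 : ℝ) ≤ N := by exact_mod_cast hN2
  have hN0 : (0 : ℝ) < N := by linarith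
  refine ⟨N, ?_⟩
  calc (3 * (N : ℝ) + 2) ^ s ≤ (5 * N) ^ s :=
        Real.rpow_le_rpow (by positivity) (by linarith) hs0.le
    _ = 5 ^ s * (N : ℝ) ^ s := Real.mul_rpow (by positivity) (by positivity)
    _ < (N : ℝ) ^ (1 - s) * (N : ℝ) ^ s := by
        gcongr; exact hN
    _ = N := by rw [← Real.rpow_add hN0]; simp

/-- A weighted Hardy inequality near a boundary point, in a chart where `h` is the height above the
boundary. -/
lemma exists_setLIntegral_height_lt_top {n : ℕ} {s : ℝ} (hs0 : 0 < s) (hs1 : s < 1)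
    {Ω : Set (Eucl n)} (hΩm : MeasurableSet Ω) {h : Eucl n → ℝ} {L : ℝ≥0} (hL1 : 1 ≤ L)
    (hL : LipschitzWith L h) {e : Eucl n} (he : ‖e‖ = 1)
    (hadd : ∀ x t, h (x + t • e) = h x + t) {p : Eucl n} {R : ℝ} (hR : 0 < R)
    (hΩ : ∀ x ∈ Metric.ball p R, x ∈ Ω ↔ 0 < h x) (hp : h p ≤ 0)
    {v : Eucl n → ℝ} (hv : Measurable v) (hint : ∫⁻ x in Ω, ‖v x‖ₑ < ∞)
    (hsemi : ∫⁻ z in Ω ×ˢ Ω, ‖v z.1 - v z.2‖ₑ * kernel s (z.1 - z.2) < ∞) :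
    ∫⁻ x in Ω ∩ Metric.ball p (R / (4 * L)), ‖v x‖ₑ * ENNReal.ofReal (h x ^ (-s)) < ∞ := by
  have hL1' : (1 : ℝ) ≤ L := by exact_mod_cast hL1
  have hL0 : (0 : ℝ) < L := by linarith
  have hh : Measurable h := hL.continuous.measurable
  obtain ⟨N, hN⟩ := exists_nat_rpow_lt hs0 hs1
  set Λ : ℝ := 3 * N + 2 with hΛ
  have hΛ2 : 2 ≤ Λ := by rw [hΛ]; linarith [Nat.cast_nonneg (α := ℝ) N]
  have hΛ0 : 0 < Λ := by linarith
  set ρ : ℝ := R / (4 * L) with hρ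
  have hρ0 : 0 < ρ := by positivity
  have hρL : L * ρ = R / 4 := by rw [hρ]; field_simp
  have hρR : ρ ≤ R / 4 := by nlinarith
  set r : ℕ → ℝ := fun k => R / 4 * (Λ⁻¹) ^ k with hr
  have hr0 (k : ℕ) : 0 < r k := by positivity
  have hrsucc (k : ℕ) : Λ * r (k + 1) = r k := by
    simp only [hr]; rw [pow_succ]; field_simp
  have hranti : Antitone r := antitone_nat_of_succ_le fun k => by
    nlinarith [hrsucc k, hr0 (k + 1)]
  have hrR (k : ℕ) : r k ≤ R / 4 := (hranti (Nat.zero_le k)).trans_eq (by simp [hr])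
  -- The ball is enlarged by 2 r_k so that a shift shorter than Λ r_{k+1} = r_k takes T_{k+1} into
  -- the ball of T_k: 2 r_{k+1} + r_k ≤ 2 r_k, as Λ ≥ 2.
  set T : ℕ → Set (Eucl n) := fun k => Metric.ball p (ρ + 2 * r k) ∩ {x | 0 < h x ∧ h x < r k}
    with hT
  have hTm (k : ℕ) : MeasurableSet (T k) :=
    Metric.isOpen_ball.measurableSet.inter
      ((measurableSet_lt measurable_const hh).inter (measurableSet_lt hh measurable_const))
  have hTΩ (k : ℕ) : T k ⊆ Ω := fun x hx =>
    (hΩ x (Metric.ball_subset_ball (by linarith [hrR k]) hx.1)).2 hx.2.1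
  set P : ℕ → Set (Eucl n × Eucl n) := fun k =>
    {z | z.1 ∈ T (k + 1) ∧ z.2 ∈ T k ∧ 2 * r (k + 1) < h z.2 - h z.1 ∧
      h z.2 - h z.1 < Λ * r (k + 1)} with hP
  have hPm (k : ℕ) : MeasurableSet (P k) := by
    have hP1 : MeasurableSet {z : Eucl n × Eucl n | 2 * r (k + 1) < h z.2 - h z.1} :=
      measurableSet_lt measurable_const (by fun_prop)
    have hP2 : MeasurableSet {z : Eucl n × Eucl n | h z.2 - h z.1 < Λ * r (k + 1)} :=
      measurableSet_lt (by fun_prop) measurable_const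
    exact ((hTm _).preimage measurable_fst).inter
      (((hTm _).preimage measurable_snd).inter (hP1.inter hP2))
  -- Height differences exceed 2 r_{k+1} on P_k but stay below Λ r_{l+1} = r_l ≤ r_{k+1} on P_l for
  -- l > k. Disjointness lets one Gagliardo energy pay for all the steps.
  have hPdisj : Pairwise (Function.onFun Disjoint P) := by
    refine (pairwise_disjoint_on P).2 fun k l hkl => ?_
    refine Set.disjoint_left.2 fun z hk hl => ?_
    have h1 := hk.2.2.1
    have h2 := hl.2.2.2
    rw [hrsucc] at h2
    have h3 : r l ≤ r (k + 1) := hranti hkl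
    linarith [hr0 (k + 1)]
  set g : Eucl n × Eucl n → ℝ≥0∞ := fun z => ‖v z.1 - v z.2‖ₑ * kernel s (z.1 - z.2) with hg
  set β := volume (Metric.ball (0 : Eucl n) (L⁻¹ : ℝ)) with hβ
  have hβ0 : β ≠ 0 := (Metric.measure_ball_pos _ _ (by positivity)).ne'
  have hβtop : β ≠ ∞ := measure_ball_lt_top.ne
  set a : ℕ → ℝ≥0∞ := fun k => ENNReal.ofReal (r k ^ (-s)) * (∫⁻ x in T k, ‖v x‖ₑ) * β with ha
  have hFtop (k : ℕ) : ∫⁻ x in T k, ‖v x‖ₑ ≠ ∞ := ((lintegral_mono_set (hTΩ k)).trans_lt hint).ne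
  have hrpow (k : ℕ) : r (k + 1) ^ (-s) = Λ ^ s * r k ^ (-s) := by
    rw [← hrsucc k, Real.mul_rpow hΛ0.le (hr0 _).le, ← mul_assoc, ← Real.rpow_add hΛ0]
    simp
  -- This is `layer_step` multiplied by r_{k+1}^(-(n+s)), which makes the error constant independent
  -- of k; passing from r_{k+1} to r_k in the weight costs Λ^s.
  have hrec (k : ℕ) : ((N : ℝ≥0) : ℝ≥0∞) * a (k + 1) ≤ (Real.toNNReal (Λ ^ s) : ℝ≥0) * a k +
      N * ENNReal.ofReal (Λ ^ ((n : ℝ) + s)) * ∫⁻ z in P k, g z := by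
    have hstep := layer_step hs0 hL1 hL he hadd N (hr0 (k + 1)) (hTm (k + 1)) (hTm k)
      (fun x hx => hx.2) (fun x hx w hw h1 h2 => by
        rw [← hΛ, hrsucc] at hw h2
        refine ⟨?_, h1, h2⟩
        have hx := hx.1
        rw [Metric.mem_ball, dist_eq_norm] at hx ⊢
        have h3 := norm_add_le (x - p) w
        rw [sub_add_eq_add_sub] at h3
        nlinarith [hrsucc k, hr0 (k + 1)]) hv
    rw [← hΛ] at hstep
    have hc : ENNReal.ofReal (r (k + 1) ^ (-((n : ℝ) + s))) * ENNReal.ofReal (r (k + 1) ^ n) =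
        ENNReal.ofReal (r (k + 1) ^ (-s)) := by
      rw [← ENNReal.ofReal_mul (Real.rpow_nonneg (hr0 _).le _), ← Real.rpow_natCast,
        ← Real.rpow_add (hr0 _)]
      congr 2; ring
    have hc' : ENNReal.ofReal (r (k + 1) ^ (-((n : ℝ) + s))) *
        ENNReal.ofReal ((Λ * r (k + 1)) ^ ((n : ℝ) + s)) = ENNReal.ofReal (Λ ^ ((n : ℝ) + s)) := by
      rw [← ENNReal.ofReal_mul (Real.rpow_nonneg (hr0 _).le _),
        Real.mul_rpow hΛ0.le (hr0 _).le, mul_left_comm, ← Real.rpow_add (hr0 _)]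
      simp
    have hmul := mul_le_mul_right hstep (ENNReal.ofReal (r (k + 1) ^ (-((n : ℝ) + s))))
    calc ((N : ℝ≥0) : ℝ≥0∞) * a (k + 1)
        = ENNReal.ofReal (r (k + 1) ^ (-((n : ℝ) + s))) * (N * (∫⁻ x in T (k + 1), ‖v x‖ₑ) *
            (ENNReal.ofReal (r (k + 1) ^ n) * β)) := by
          simp only [ha, ENNReal.coe_natCast]; rw [← hc]; ring
      _ ≤ _ := hmul
      _ = (ENNReal.ofReal (r (k + 1) ^ (-((n : ℝ) + s))) * ENNReal.ofReal (r (k + 1) ^ n)) *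
            (∫⁻ x in T k, ‖v x‖ₑ) * β + N * (ENNReal.ofReal (r (k + 1) ^ (-((n : ℝ) + s))) *
            ENNReal.ofReal ((Λ * r (k + 1)) ^ ((n : ℝ) + s))) * ∫⁻ z in P k, g z := by ring
      _ = _ := by
          rw [hc, hc', hrpow, ENNReal.ofReal_mul (by positivity)]
          simp only [ha, ENNReal.ofReal]
          ring
  have hPsum : ∑' k, ∫⁻ z in P k, g z < ∞ := by
    rw [← lintegral_iUnion hPm hPdisj]
    refine (lintegral_mono_set (Set.iUnion_subset fun k z hz => ?_)).trans_lt hsemi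
    exact ⟨hTΩ _ hz.1, hTΩ _ hz.2.1⟩
  have hasum : ∑' k, a k < ∞ := by
    refine tsum_lt_top_of_mul_succ_le ?_ ?_ ?_ hrec
    · rw [← NNReal.coe_lt_coe, Real.coe_toNNReal _ (by positivity)]
      exact_mod_cast hN
    · exact ENNReal.mul_ne_top (ENNReal.mul_ne_top ENNReal.ofReal_ne_top (hFtop 0)) hβtop
    · rw [ENNReal.tsum_mul_left]
      exact ENNReal.mul_ne_top (by finiteness) hPsum.ne
  have hpt : ∀ x ∈ Ω ∩ Metric.ball p ρ, ‖v x‖ₑ * ENNReal.ofReal (h x ^ (-s)) ≤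
      ∑' k, (T k).indicator (fun x => ENNReal.ofReal (r (k + 1) ^ (-s)) * ‖v x‖ₑ) x := by
    intro x ⟨hxΩ, hxp⟩
    have hx0 : 0 < h x := (hΩ x (Metric.ball_subset_ball (by linarith) hxp)).1 hxΩ
    have hx1 : h x < r 0 := by
      have h1 := hL.dist_le_mul x p
      have h2 : L * dist x p < L * ρ := mul_lt_mul_of_pos_left hxp hL0
      rw [Real.dist_eq] at h1
      simp only [hr, pow_zero, mul_one]
      linarith [le_abs_self (h x - h p)]
    have hlim : Tendsto r atTop (𝓝 0) := by
      have := (tendsto_pow_atTop_nhds_zero_of_lt_one (r := Λ⁻¹) (by positivity)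
        (inv_lt_one_of_one_lt₀ (by linarith))).const_mul (R / 4)
      rwa [mul_zero] at this
    have hex : ∃ k, r k ≤ h x := ((hlim.eventually_lt_const hx0).exists).imp fun _ hk => hk.le
    classical
    -- Here k + 1 is the first index with r ≤ h x; it is not 0 because h x < r 0.
    obtain ⟨k, hk, hk'⟩ : ∃ k, r (k + 1) ≤ h x ∧ h x < r k := by
      have h0 : Nat.find hex ≠ 0 := fun h0 => by
        have := Nat.find_spec hex
        rw [h0] at this
        linarith
      obtain ⟨k, hk⟩ := Nat.exists_eq_succ_of_ne_zero h0
      have hspec := Nat.find_spec hex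
      rw [hk] at hspec
      exact ⟨k, hspec, not_le.1 (Nat.find_min hex (by omega))⟩
    have hxT : x ∈ T k := ⟨Metric.ball_subset_ball (by linarith [hr0 k]) hxp, hx0, hk'⟩
    refine le_trans ?_ (ENNReal.le_tsum k)
    rw [Set.indicator_of_mem hxT, mul_comm]
    gcongr ENNReal.ofReal ?_ * _
    exact Real.rpow_le_rpow_of_nonpos (hr0 _) hk (by linarith)
  calc ∫⁻ x in Ω ∩ Metric.ball p ρ, ‖v x‖ₑ * ENNReal.ofReal (h x ^ (-s))
      ≤ ∫⁻ x in Ω ∩ Metric.ball p ρ,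
        ∑' k, (T k).indicator (fun x => ENNReal.ofReal (r (k + 1) ^ (-s)) * ‖v x‖ₑ) x :=
        setLIntegral_mono' (hΩm.inter Metric.isOpen_ball.measurableSet) hpt
    _ ≤ ∫⁻ x, ∑' k, (T k).indicator (fun x => ENNReal.ofReal (r (k + 1) ^ (-s)) * ‖v x‖ₑ) x :=
        setLIntegral_le_lintegral _ _
    _ = ∑' k, ENNReal.ofReal (r (k + 1) ^ (-s)) * ∫⁻ x in T k, ‖v x‖ₑ := by
        rw [lintegral_tsum fun k =>
          (Measurable.indicator (by fun_prop) (hTm k)).aemeasurable]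
        congr 1 with k
        rw [lintegral_indicator (hTm k), lintegral_const_mul' _ _ ENNReal.ofReal_ne_top]
    _ = ENNReal.ofReal (Λ ^ s) * β⁻¹ * ∑' k, a k := by
        rw [← ENNReal.tsum_mul_left]
        congr 1 with k
        rw [hrpow, ENNReal.ofReal_mul (by positivity)]
        simp only [ha]
        calc _ = ENNReal.ofReal (Λ ^ s) * ENNReal.ofReal (r k ^ (-s)) *
              (∫⁻ x in T k, ‖v x‖ₑ) * (β⁻¹ * β) := by
              rw [ENNReal.inv_mul_cancel hβ0 hβtop, mul_one]
          _ = _ := by ring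
    _ < ∞ := ENNReal.mul_lt_top (ENNReal.mul_lt_top ENNReal.ofReal_lt_top
        (ENNReal.inv_lt_top.2 (pos_iff_ne_zero.2 hβ0))) hasum

/-- The height function above a Lipschitz boundary near a boundary point. -/
lemma HasLipschitzBoundary.exists_height {n : ℕ} {Ω : Set (Eucl n)} (hΩ : HasLipschitzBoundary Ω)
    {p : Eucl n} (hp : p ∈ frontier Ω) :
    ∃ (e : Eucl n) (h : Eucl n → ℝ) (L : ℝ≥0) (R : ℝ), ‖e‖ = 1 ∧ 1 ≤ L ∧ LipschitzWith L h ∧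
      (∀ x t, h (x + t • e) = h x + t) ∧ 0 < R ∧ ∀ x ∈ Metric.ball p R, x ∈ Ω ↔ 0 < h x := by
  obtain ⟨e, he, K, g, hg, hev⟩ := hΩ p hp
  obtain ⟨R, hR, hball⟩ := Metric.eventually_nhds_iff_ball.1 hev
  set π := (Submodule.span ℝ {e})ᗮ.orthogonalProjectionOnto with hπ
  refine ⟨e, fun x => inner ℝ e x - g (π x), 1 + K, R, he, le_self_add, ?_, ?_, hR, ?_⟩
  · refine LipschitzWith.of_dist_le_mul fun x y => ?_
    have h1 : |inner ℝ e (x - y)| ≤ ‖x - y‖ := by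
      simpa [he] using abs_real_inner_le_norm e (x - y)
    have h2 : |g (π x) - g (π y)| ≤ K * ‖x - y‖ := by
      have := hg.dist_le_mul (π x) (π y)
      rw [Real.dist_eq, dist_eq_norm, ← map_sub] at this
      refine this.trans ?_
      gcongr
      exact Submodule.norm_orthogonalProjectionOnto_apply_le _ _
    rw [inner_sub_right] at h1
    rw [Real.dist_eq, dist_eq_norm, NNReal.coe_add, NNReal.coe_one, add_mul, one_mul]
    calc _ = |(inner ℝ e x - inner ℝ e y) - (g (π x) - g (π y))| := by congr 1; ring
      _ ≤ _ := abs_sub _ _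
      _ ≤ _ := add_le_add h1 h2
  · intro x t
    -- Moving along e leaves the projection, hence g, unchanged.
    have h1 : π e = 0 := by
      rw [hπ, Submodule.orthogonalProjectionOnto_eq_zero_iff, Submodule.orthogonal_orthogonal]
      exact Submodule.mem_span_singleton_self e
    have h2 : inner ℝ e e = (1 : ℝ) := by rw [real_inner_self_eq_norm_sq, he, one_pow]
    simp only [map_add, map_smul, h1, smul_zero, add_zero, inner_add_right, inner_smul_right, h2]
    ring
  · intro x hx
    rw [hball x hx, sub_pos]

/-- **Fractional Hardy inequality** (qualitative form): the trivial extension of a function of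
`W^{s,1}(Ω)`, `s < 1`, has finite interaction energy with the complement of `Ω`. -/
theorem lintegral_mul_kernel_compl_lt_top {n : ℕ} {s : ℝ} (hs0 : 0 < s) (hs1 : s < 1)
    {Ω : Set (Eucl n)} (hΩo : IsOpen Ω) (hΩb : Bornology.IsBounded Ω)
    (hΩ : HasLipschitzBoundary Ω) {v : Eucl n → ℝ} (hv : Measurable v)
    (hint : ∫⁻ x in Ω, ‖v x‖ₑ < ∞)
    (hsemi : ∫⁻ z in Ω ×ˢ Ω, ‖v z.1 - v z.2‖ₑ * kernel s (z.1 - z.2) < ∞) :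
    ∫⁻ x in Ω, ‖v x‖ₑ * ∫⁻ y in Ωᶜ, kernel s (x - y) < ∞ := by
  set C := ∫⁻ w in {w : Eucl n | 1 ≤ ‖w‖}, kernel s w with hC
  have hCtop : C < ∞ := setLIntegral_kernel_lt_top hs0
  -- Local finiteness suffices, by compactness of the closure. At interior points the complement
  -- stays a fixed distance away; at boundary points its distance is at least h / L.
  have hlocal : ∀ p ∈ closure Ω, ∃ U ∈ 𝓝[closure Ω] p,
      ∫⁻ x in Ω ∩ U, ‖v x‖ₑ * ∫⁻ y in Ωᶜ, kernel s (x - y) < ∞ := by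
    intro p hp
    by_cases hpΩ : p ∈ Ω
    · obtain ⟨R, hR, hball⟩ := Metric.isOpen_iff.1 hΩo p hpΩ
      refine ⟨Metric.ball p (R / 2), mem_nhdsWithin_of_mem_nhds (Metric.ball_mem_nhds _ (by linarith)),
        ?_⟩
      calc ∫⁻ x in Ω ∩ Metric.ball p (R / 2), ‖v x‖ₑ * ∫⁻ y in Ωᶜ, kernel s (x - y)
          ≤ ∫⁻ x in Ω ∩ Metric.ball p (R / 2), ‖v x‖ₑ * (ENNReal.ofReal ((R / 2) ^ (-s)) * C) := by
            refine setLIntegral_mono' (hΩo.measurableSet.inter Metric.isOpen_ball.measurableSet)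
              fun x hx => ?_
            gcongr
            refine setLIntegral_kernel_compl_le s (by linarith) fun y hy => ?_
            by_contra! hlt
            refine hy (hball ?_)
            have h1 := hx.2
            rw [Metric.mem_ball] at h1 ⊢
            rw [← dist_eq_norm, dist_comm] at hlt
            linarith [dist_triangle y x p]
        _ ≤ ∫⁻ x in Ω, ‖v x‖ₑ * (ENNReal.ofReal ((R / 2) ^ (-s)) * C) :=
            lintegral_mono_set Set.inter_subset_left
        _ < ∞ := by
            rw [lintegral_mul_const _ (by fun_prop)]
            exact ENNReal.mul_lt_top hint (ENNReal.mul_lt_top ENNReal.ofReal_lt_top hCtop)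
    · have hpf : p ∈ frontier Ω := by rw [hΩo.frontier_eq]; exact ⟨hp, hpΩ⟩
      obtain ⟨e, h, L, R, he, hL1, hL, hadd, hR, hball⟩ := hΩ.exists_height hpf
      have hL1' : (1 : ℝ) ≤ L := by exact_mod_cast hL1
      have hL0 : (0 : ℝ) < L := by linarith
      have hp0 : h p ≤ 0 := not_lt.1 fun h0 => hpΩ ((hball p (Metric.mem_ball_self hR)).2 h0)
      set ρ := R / (4 * L) with hρ
      have hρL : L * ρ = R / 4 := by rw [hρ]; field_simp
      have hρ0 : 0 < ρ := by positivity
      have hρR : ρ ≤ R / 4 := by nlinarith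
      refine ⟨Metric.ball p ρ, mem_nhdsWithin_of_mem_nhds (Metric.ball_mem_nhds _ hρ0), ?_⟩
      have hmain := exists_setLIntegral_height_lt_top hs0 hs1 hΩo.measurableSet hL1 hL he hadd hR
        hball hp0 hv hint hsemi
      calc ∫⁻ x in Ω ∩ Metric.ball p ρ, ‖v x‖ₑ * ∫⁻ y in Ωᶜ, kernel s (x - y)
          ≤ ∫⁻ x in Ω ∩ Metric.ball p ρ, (‖v x‖ₑ * ENNReal.ofReal (h x ^ (-s))) *
              (ENNReal.ofReal ((L⁻¹ : ℝ) ^ (-s)) * C) := by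
            refine setLIntegral_mono' (hΩo.measurableSet.inter Metric.isOpen_ball.measurableSet)
              fun x ⟨hxΩ, hxp⟩ => ?_
            rw [Metric.mem_ball] at hxp
            have hx0 : 0 < h x := (hball x (Metric.mem_ball.2 (by linarith))).1 hxΩ
            -- Inside the chart, h y ≤ 0 and the Lipschitz bound applies. A point y outside the
            -- chart is at distance at least R - ρ from x, while h x ≤ R / 4.
            have hdist : ∀ y ∈ Ωᶜ, h x * (L⁻¹ : ℝ) ≤ ‖x - y‖ := by
              intro y hy
              rw [← div_eq_mul_inv, div_le_iff₀ hL0, ← dist_eq_norm]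
              by_cases hyR : y ∈ Metric.ball p R
              · have h1 : h y ≤ 0 := not_lt.1 fun h0 => hy ((hball y hyR).2 h0)
                have h2 := hL.dist_le_mul x y
                rw [Real.dist_eq] at h2
                linarith [le_abs_self (h x - h y)]
              · have h1 := hL.dist_le_mul x p
                rw [Real.dist_eq] at h1
                have h2 : R ≤ dist y p := not_lt.1 hyR
                have h3 := dist_triangle y x p
                rw [dist_comm y x] at h3
                nlinarith [le_abs_self (h x - h p)]
            have := setLIntegral_kernel_compl_le s (by positivity) hdist
            rw [Real.mul_rpow hx0.le (by positivity), ENNReal.ofReal_mul (by positivity)] at this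
            rw [mul_assoc, ← mul_assoc (ENNReal.ofReal _)]
            gcongr
        _ < ∞ := by
            rw [lintegral_mul_const' _ _ (ENNReal.mul_ne_top ENNReal.ofReal_ne_top hCtop.ne)]
            exact ENNReal.mul_lt_top hmain (ENNReal.mul_lt_top ENNReal.ofReal_lt_top hCtop)
  have hcpt : IsCompact (closure Ω) := hΩb.isCompact_closure
  have := hcpt.induction_on (p := fun U => ∫⁻ x in Ω ∩ U, ‖v x‖ₑ * ∫⁻ y in Ωᶜ, kernel s (x - y) < ∞)
    (by simp) (fun U V hUV hV => (lintegral_mono_set (by gcongr)).trans_lt hV)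
    (fun U V hU hV => by
      rw [Set.inter_union_distrib_left]
      exact (lintegral_union_le _ _ _).trans_lt (ENNReal.add_lt_top.2 ⟨hU, hV⟩)) hlocal
  rwa [Set.inter_eq_left.2 subset_closure] at this

/-! ### Energy density and the space 𝒲^s(Ω) -/

/-- The integrand of the Gagliardo energy, with values in `[0, ∞]`. -/
noncomputable def energyDensity {n : ℕ} (s : ℝ) (u : Eucl n → ℝ) (z : Eucl n × Eucl n) : ℝ≥0∞ :=
  ‖u z.1 - u z.2‖ₑ * kernel s (z.1 - z.2)

lemma enorm_div_norm_rpow {n : ℕ} (s a : ℝ) (w : Eucl n) :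
    ‖a / ‖w‖ ^ ((n : ℝ) + s)‖ₑ = ‖a‖ₑ * kernel s w := by
  rw [div_eq_mul_inv, enorm_mul, kernel, Real.enorm_of_nonneg (r := (_)⁻¹) (by positivity)]

lemma gagliardoQuotient_nonneg {n : ℕ} (s : ℝ) (u : Eucl n → ℝ) (x y : Eucl n) :
    0 ≤ gagliardoQuotient s u x y := by
  unfold gagliardoQuotient; positivity

lemma ofReal_gagliardoQuotient {n : ℕ} (s : ℝ) (u : Eucl n → ℝ) (z : Eucl n × Eucl n) :
    ENNReal.ofReal (gagliardoQuotient s u z.1 z.2) = energyDensity s u z := by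
  rw [← Real.enorm_of_nonneg (gagliardoQuotient_nonneg s u z.1 z.2), gagliardoQuotient,
    enorm_div_norm_rpow, energyDensity, Real.enorm_abs]

section Measurability

variable {n : ℕ} {s : ℝ} {u v : Eucl n → ℝ}

lemma aemeasurable_comp_fst (hu : AEMeasurable u volume) :
    AEMeasurable (fun z : Eucl n × Eucl n => u z.1) volume :=
  hu.comp_quasiMeasurePreserving Measure.quasiMeasurePreserving_fst

lemma aemeasurable_comp_snd (hu : AEMeasurable u volume) :
    AEMeasurable (fun z : Eucl n × Eucl n => u z.2) volume :=
  hu.comp_quasiMeasurePreserving Measure.quasiMeasurePreserving_snd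

lemma aemeasurable_energyDensity (hu : AEMeasurable u volume) :
    AEMeasurable (energyDensity s u) volume := by
  have h1 := aemeasurable_comp_fst hu
  have h2 := aemeasurable_comp_snd hu
  have h3 := measurable_kernel (n := n) s
  unfold energyDensity
  fun_prop

lemma aemeasurable_gagliardoQuotient (hu : AEMeasurable u volume) :
    AEMeasurable (fun z : Eucl n × Eucl n => gagliardoQuotient s u z.1 z.2) volume := by
  have h1 := aemeasurable_comp_fst hu
  have h2 := aemeasurable_comp_snd hu
  unfold gagliardoQuotient
  refine AEMeasurable.div ?_ ?_
  · exact (h1.sub h2).abs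
  · fun_prop

lemma ae_prod_and {p : Eucl n → Prop} (hp : ∀ᵐ x, p x) :
    ∀ᵐ z : Eucl n × Eucl n, p z.1 ∧ p z.2 :=
  (Measure.quasiMeasurePreserving_fst.ae hp).and (Measure.quasiMeasurePreserving_snd.ae hp)

lemma energyDensity_congr_ae (h : u =ᵐ[volume] v) :
    energyDensity s u =ᵐ[volume] energyDensity s v := by
  filter_upwards [ae_prod_and h] with z hz
  rw [energyDensity, energyDensity, hz.1, hz.2]

end Measurability

lemma gagliardoSeminorm_eq {n : ℕ} {s : ℝ} {Ω : Set (Eucl n)} {u : Eucl n → ℝ}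
    (hu : AEMeasurable u volume) :
    gagliardoSeminorm s Ω u = ∫⁻ z in Ω ×ˢ Ω, energyDensity s u z := by
  rw [Measure.volume_eq_prod,
    setLIntegral_prod _ (by exact (aemeasurable_energyDensity hu).restrict)]
  simp_rw [← ofReal_gagliardoQuotient]
  rfl

lemma mem_SobolevW_iff {n : ℕ} {s : ℝ} {Ω : Set (Eucl n)} {u : Eucl n → ℝ} :
    u ∈ SobolevW s Ω ↔ AEMeasurable u volume ∧ IntegrableOn u Ω volume ∧
      ∫⁻ z in Ω ×ˢ Ω, energyDensity s u z < ∞ := by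
  constructor
  · rintro ⟨h1, h2, h3⟩
    exact ⟨h1, h2, by rwa [← gagliardoSeminorm_eq h1]⟩
  · rintro ⟨h1, h2, h3⟩
    exact ⟨h1, h2, by rwa [gagliardoSeminorm_eq h1]⟩

lemma SobolevW_congr_ae {n : ℕ} {s : ℝ} {Ω : Set (Eucl n)} {u v : Eucl n → ℝ}
    (hu : u ∈ SobolevW s Ω) (h : u =ᵐ[volume] v) : v ∈ SobolevW s Ω := by
  rw [mem_SobolevW_iff] at hu ⊢
  refine ⟨hu.1.congr h, hu.2.1.congr_fun_ae (ae_restrict_of_ae h), ?_⟩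
  rw [← lintegral_congr_ae (ae_restrict_of_ae (energyDensity_congr_ae h))]
  exact hu.2.2

lemma enorm_le_add_of_abs_le {a b c : ℝ} (h : |a| ≤ |b| + |c|) : ‖a‖ₑ ≤ ‖b‖ₑ + ‖c‖ₑ := by
  rw [Real.enorm_eq_ofReal_abs, Real.enorm_eq_ofReal_abs, Real.enorm_eq_ofReal_abs,
    ← ENNReal.ofReal_add (abs_nonneg _) (abs_nonneg _)]
  exact ENNReal.ofReal_le_ofReal h

/-- Comparison criterion for membership in `𝒲^s(Ω)`. -/
lemma mem_SobolevW_of_abs_sub_le {n : ℕ} {s : ℝ} {Ω : Set (Eucl n)} (hΩ : MeasurableSet Ω)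
    {u v w : Eucl n → ℝ} (hu : AEMeasurable u volume)
    (hu' : ∫⁻ z in Ω ×ˢ Ω, energyDensity s u z < ∞)
    (hv' : ∫⁻ z in Ω ×ˢ Ω, energyDensity s v z < ∞) (hw : AEMeasurable w volume)
    (hwi : IntegrableOn w Ω volume)
    (h : ∀ x ∈ Ω, ∀ y ∈ Ω, |w x - w y| ≤ |u x - u y| + |v x - v y|) : w ∈ SobolevW s Ω := by
  refine mem_SobolevW_iff.2 ⟨hw, hwi, ?_⟩
  calc ∫⁻ z in Ω ×ˢ Ω, energyDensity s w z
      ≤ ∫⁻ z in Ω ×ˢ Ω, (energyDensity s u z + energyDensity s v z) := by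
        refine setLIntegral_mono' (hΩ.prod hΩ) fun z hz => ?_
        rw [energyDensity, energyDensity, energyDensity, ← add_mul]
        gcongr
        exact enorm_le_add_of_abs_le (h _ hz.1 _ hz.2)
    _ = (∫⁻ z in Ω ×ˢ Ω, energyDensity s u z) + ∫⁻ z in Ω ×ˢ Ω, energyDensity s v z :=
        lintegral_add_left' (aemeasurable_energyDensity hu).restrict _
    _ < ∞ := ENNReal.add_lt_top.2 ⟨hu', hv'⟩

lemma sub_mem_SobolevW {n : ℕ} {s : ℝ} {Ω : Set (Eucl n)} (hΩ : MeasurableSet Ω)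
    {u v : Eucl n → ℝ} (hu : u ∈ SobolevW s Ω) (hv : v ∈ SobolevW s Ω) :
    (fun x => u x - v x) ∈ SobolevW s Ω := by
  rw [mem_SobolevW_iff] at hu hv
  refine mem_SobolevW_of_abs_sub_le hΩ hu.1 hu.2.2 hv.2.2 (hu.1.sub hv.1) (hu.2.1.sub hv.2.1) ?_
  intro x _ y _
  rw [sub_sub_sub_comm]
  exact abs_sub _ _

lemma const_mem_SobolevW {n : ℕ} {s : ℝ} {Ω : Set (Eucl n)} (hΩb : Bornology.IsBounded Ω) (c : ℝ) :
    (fun _ => c) ∈ SobolevW s Ω :=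
  mem_SobolevW_iff.2 ⟨aemeasurable_const, integrableOn_const hΩb.measure_lt_top.ne, by
    simp [energyDensity]⟩

/-! ### Interactions across the boundary and finiteness over Q(Ω) -/

section Hardy

variable {n : ℕ} {s : ℝ} {Ω : Set (Eucl n)} {w : Eucl n → ℝ}

lemma setLIntegral_fst_mul_kernel_lt_top (hs0 : 0 < s) (hs1 : s < 1)
    (hΩo : IsOpen Ω) (hΩb : Bornology.IsBounded Ω)
    (hΩ : HasLipschitzBoundary Ω) (hw : w ∈ SobolevW s Ω) :
    ∫⁻ z in Ω ×ˢ Ωᶜ, ‖w z.1‖ₑ * kernel s (z.1 - z.2) < ∞ := by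
  have hk := measurable_kernel (n := n) s
  have hae := (mem_SobolevW_iff.1 hw).1.ae_eq_mk
  have hmeas := (mem_SobolevW_iff.1 hw).1.measurable_mk
  set v := (mem_SobolevW_iff.1 hw).1.mk w
  have hv := mem_SobolevW_iff.1 (SobolevW_congr_ae hw hae)
  have heq : (fun z : Eucl n × Eucl n => ‖w z.1‖ₑ * kernel s (z.1 - z.2)) =ᵐ[volume]
      fun z => ‖v z.1‖ₑ * kernel s (z.1 - z.2) := by
    filter_upwards [ae_prod_and hae] with z hz
    rw [hz.1]
  rw [lintegral_congr_ae (ae_restrict_of_ae heq), Measure.volume_eq_prod,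
    setLIntegral_prod _ (by fun_prop)]
  simp only
  have := lintegral_mul_kernel_compl_lt_top hs0 hs1 hΩo hΩb hΩ hmeas hv.2.1.2 hv.2.2
  refine lt_of_eq_of_lt (lintegral_congr fun x => ?_) this
  rw [lintegral_const_mul _ (by fun_prop)]

lemma setLIntegral_snd_mul_kernel_lt_top (hs0 : 0 < s) (hs1 : s < 1)
    (hΩo : IsOpen Ω) (hΩb : Bornology.IsBounded Ω)
    (hΩ : HasLipschitzBoundary Ω) (hw : w ∈ SobolevW s Ω) :
    ∫⁻ z in Ωᶜ ×ˢ Ω, ‖w z.2‖ₑ * kernel s (z.1 - z.2) < ∞ := by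
  refine lt_of_eq_of_lt ?_ (setLIntegral_fst_mul_kernel_lt_top hs0 hs1 hΩo hΩb hΩ hw)
  have hswap : MeasurePreserving (Prod.swap : Eucl n × Eucl n → _) volume volume :=
    Measure.measurePreserving_swap
  rw [← hswap.setLIntegral_comp_preimage_emb MeasurableEquiv.prodComm.measurableEmbedding _
    (Ω ×ˢ Ωᶜ), Set.preimage_swap_prod]
  simp only [Prod.fst_swap, Prod.snd_swap]
  refine lintegral_congr fun z => ?_
  rw [kernel_sub_comm]

lemma setLIntegral_Q_le (f : Eucl n × Eucl n → ℝ≥0∞) :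
    ∫⁻ z in Q Ω, f z ≤ (∫⁻ z in Ω ×ˢ Ω, f z) +
      ((∫⁻ z in Ω ×ˢ Ωᶜ, f z) + ∫⁻ z in Ωᶜ ×ˢ Ω, f z) := by
  have hsub : Q Ω ⊆ Ω ×ˢ Ω ∪ (Ω ×ˢ Ωᶜ ∪ Ωᶜ ×ˢ Ω) := by
    rintro z hz
    simp only [Q, Set.mem_compl_iff, Set.mem_prod, Set.mem_union] at hz ⊢
    tauto
  exact (lintegral_mono_set hsub).trans ((lintegral_union_le _ _ _).trans
    (add_le_add_right (lintegral_union_le _ _ _) _))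

/-- Finiteness over `Q(Ω)` of quantities controlled by the energies of `u` and `v` in `Ω`, and by
the difference `u - v` elsewhere. -/
lemma setLIntegral_Q_lt_top (hs0 : 0 < s) (hs1 : s < 1)
    (hΩo : IsOpen Ω) (hΩb : Bornology.IsBounded Ω) (hΩ : HasLipschitzBoundary Ω)
    {u v : Eucl n → ℝ} (hu : u ∈ SobolevW s Ω) (hv : v ∈ SobolevW s Ω)
    (huv : ∀ᵐ x : Eucl n, x ∉ Ω → u x = v x) {f : Eucl n × Eucl n → ℝ≥0∞}
    (hf1 : ∀ z, f z ≤ energyDensity s u z + energyDensity s v z)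
    (hf2 : ∀ z, f z ≤ (‖u z.1 - v z.1‖ₑ + ‖u z.2 - v z.2‖ₑ) * kernel s (z.1 - z.2)) :
    ∫⁻ z in Q Ω, f z < ∞ := by
  have hΩm := hΩo.measurableSet
  have hw := sub_mem_SobolevW hΩm hu hv
  refine (setLIntegral_Q_le f).trans_lt (ENNReal.add_lt_top.2 ⟨?_, ENNReal.add_lt_top.2 ⟨?_, ?_⟩⟩)
  · refine (lintegral_mono hf1).trans_lt ?_
    rw [lintegral_add_left' (aemeasurable_energyDensity hu.1).restrict]
    exact ENNReal.add_lt_top.2 ⟨(mem_SobolevW_iff.1 hu).2.2, (mem_SobolevW_iff.1 hv).2.2⟩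
  · refine lt_of_le_of_lt ?_ (setLIntegral_fst_mul_kernel_lt_top hs0 hs1 hΩo hΩb hΩ hw)
    refine lintegral_mono_ae ((ae_restrict_iff' (hΩm.prod hΩm.compl)).2 ?_)
    filter_upwards [ae_prod_and huv] with z hz hzΩ
    have := hf2 z
    rwa [hz.2 hzΩ.2, sub_self, enorm_zero, add_zero] at this
  · refine lt_of_le_of_lt ?_ (setLIntegral_snd_mul_kernel_lt_top hs0 hs1 hΩo hΩb hΩ hw)
    refine lintegral_mono_ae ((ae_restrict_iff' (hΩm.compl.prod hΩm)).2 ?_)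
    filter_upwards [ae_prod_and huv] with z hz hzΩ
    have := hf2 z
    rwa [hz.1 hzΩ.1, sub_self, enorm_zero, zero_add] at this

end Hardy

/-! ### Fractional perimeter as an energy -/

section FracPer

variable {n : ℕ} {s : ℝ} {Ω E F : Set (Eucl n)}

lemma fracPer_eq : fracPer s E Ω =
    (1 / 2) * ∫⁻ z in Q Ω, energyDensity s (E.indicator 1) z := by
  simp_rw [fracPer, ofReal_gagliardoQuotient]

lemma fracPer_congr_ae (h : E =ᵐ[volume] F) : fracPer s E Ω = fracPer s F Ω := by
  rw [fracPer_eq, fracPer_eq]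
  congr 1
  exact lintegral_congr_ae (ae_restrict_of_ae (energyDensity_congr_ae
    (indicator_ae_eq_of_ae_eq_set h)))

lemma fracPer_le_fracPer_iff : fracPer s E Ω ≤ fracPer s F Ω ↔
    ∫⁻ z in Q Ω, energyDensity s (E.indicator 1) z ≤
      ∫⁻ z in Q Ω, energyDensity s (F.indicator 1) z := by
  rw [fracPer_eq, fracPer_eq]
  exact ENNReal.mul_le_mul_iff_right (by simp) (by simp)

lemma fracPer_lt_top_iff : fracPer s E Ω < ∞ ↔
    ∫⁻ z in Q Ω, energyDensity s (E.indicator 1) z < ∞ := by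
  rw [fracPer_eq, ENNReal.mul_lt_top_iff]
  simp +contextual [lt_top_iff_ne_top]

end FracPer

/-! ### Coarea formula; from minimal sets to minimal functions -/

lemma abs_indicator_superlevel_sub {α : Type*} (u : α → ℝ) (x y : α) (t : ℝ) :
    |{x | t ≤ u x}.indicator (1 : α → ℝ) x - {x | t ≤ u x}.indicator (1 : α → ℝ) y| =
      (Set.uIoc (u x) (u y)).indicator 1 t := by
  classical
  simp only [Set.indicator_apply, Set.mem_ofPred_eq, Pi.one_apply, Set.mem_uIoc]
  by_cases h1 : t ≤ u x <;> by_cases h2 : t ≤ u y <;> simp [h1, h2, ← not_le]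

/-- If t separates neither a from c nor b from d, it separates a from b exactly when it separates c
from d. -/
lemma abs_indicator_uIoc_sub_le (a b c d t : ℝ) :
    |(Set.uIoc a b).indicator (1 : ℝ → ℝ) t - (Set.uIoc c d).indicator 1 t| ≤
      |(Set.uIoc a c).indicator (1 : ℝ → ℝ) t| + |(Set.uIoc b d).indicator (1 : ℝ → ℝ) t| := by
  classical
  simp only [Set.indicator_apply, Pi.one_apply, Set.mem_uIoc]
  by_cases ha : t ≤ a <;> by_cases hb : t ≤ b <;> by_cases hc : t ≤ c <;> by_cases hd : t ≤ d <;>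
    simp [ha, hb, hc, hd, ← not_le]

lemma integrable_indicator_uIoc (a b : ℝ) :
    Integrable ((Set.uIoc a b).indicator (1 : ℝ → ℝ)) volume :=
  (integrable_indicator_iff measurableSet_uIoc).2
    (integrableOn_const (by rw [Real.volume_uIoc]; exact ENNReal.ofReal_ne_top))

lemma lintegral_enorm_indicator_uIoc (a b : ℝ) :
    ∫⁻ t, ‖(Set.uIoc a b).indicator (1 : ℝ → ℝ) t‖ₑ = ‖a - b‖ₑ := by
  simp_rw [enorm_indicator_eq_indicator_enorm]
  rw [lintegral_indicator measurableSet_uIoc]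
  simp [Real.volume_uIoc, Real.enorm_eq_ofReal_abs, abs_sub_comm]

lemma integral_indicator_uIoc (a b : ℝ) :
    ∫ t, (Set.uIoc a b).indicator (1 : ℝ → ℝ) t = |a - b| := by
  rw [integral_indicator_one measurableSet_uIoc, Measure.real, Real.volume_uIoc,
    ENNReal.toReal_ofReal (abs_nonneg _), abs_sub_comm]

lemma integral_sub_nonpos_of_lintegral_le {α : Type*} [MeasurableSpace α] {μ : Measure α}
    {f g : α → ℝ} (hf : AEMeasurable f μ) (hg : AEMeasurable g μ) (hf0 : ∀ x, 0 ≤ f x)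
    (hg0 : ∀ x, 0 ≤ g x) (hfin : ∫⁻ x, ENNReal.ofReal (f x) ∂μ < ∞)
    (hle : ∫⁻ x, ENNReal.ofReal (f x) ∂μ ≤ ∫⁻ x, ENNReal.ofReal (g x) ∂μ) :
    ∫ x, (f x - g x) ∂μ ≤ 0 := by
  -- If the difference is not integrable, the Bochner integral is 0 by convention. Otherwise g = f -
  -- (f - g) is integrable too.
  by_cases hint : Integrable (fun x => f x - g x) μ
  · have hfi : Integrable f μ := by
      refine ⟨hf.aestronglyMeasurable, ?_⟩
      rwa [hasFiniteIntegral_iff_ofReal (ae_of_all _ hf0)]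
    have hgi : Integrable g μ := by
      refine (hfi.sub hint).congr (ae_of_all _ fun x => ?_)
      simp
    rw [integral_sub hfi hgi, sub_nonpos, integral_eq_lintegral_of_nonneg_ae (ae_of_all _ hf0)
      hf.aestronglyMeasurable, integral_eq_lintegral_of_nonneg_ae (ae_of_all _ hg0)
      hg.aestronglyMeasurable]
    refine ENNReal.toReal_mono ?_ hle
    exact ((hasFiniteIntegral_iff_ofReal (ae_of_all _ hg0)).1 hgi.2).ne
  · rw [integral_undef hint]

section Coarea

variable {n : ℕ} {s : ℝ} {Ω : Set (Eucl n)} {u v : Eucl n → ℝ}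

/-- The integrand of the coarea formula for the difference of the energies of `u` and `v`. -/
noncomputable def coareaIntegrand (s : ℝ) (u v : Eucl n → ℝ) (z : Eucl n × Eucl n) (t : ℝ) : ℝ :=
  ((Set.uIoc (u z.1) (u z.2)).indicator 1 t - (Set.uIoc (v z.1) (v z.2)).indicator 1 t) /
    ‖z.1 - z.2‖ ^ ((n : ℝ) + s)

lemma coareaIntegrand_eq (z : Eucl n × Eucl n) (t : ℝ) :
    coareaIntegrand s u v z t = gagliardoQuotient s ({x | t ≤ u x}.indicator 1) z.1 z.2 -
      gagliardoQuotient s ({x | t ≤ v x}.indicator 1) z.1 z.2 := by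
  rw [gagliardoQuotient, gagliardoQuotient, abs_indicator_superlevel_sub,
    abs_indicator_superlevel_sub, coareaIntegrand, sub_div]

lemma integral_coareaIntegrand (z : Eucl n × Eucl n) :
    ∫ t, coareaIntegrand s u v z t =
      (|u z.1 - u z.2| - |v z.1 - v z.2|) / ‖z.1 - z.2‖ ^ ((n : ℝ) + s) := by
  simp_rw [coareaIntegrand]
  rw [integral_div, integral_sub (integrable_indicator_uIoc _ _) (integrable_indicator_uIoc _ _),
    integral_indicator_uIoc, integral_indicator_uIoc]

lemma measurable_coareaIntegrand (hu : Measurable u) (hv : Measurable v) :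
    Measurable (Function.uncurry (coareaIntegrand s u v)) := by
  have key {w : Eucl n → ℝ} (hw : Measurable w) : Measurable
      (fun p : (Eucl n × Eucl n) × ℝ => (Set.uIoc (w p.1.1) (w p.1.2)).indicator (1 : ℝ → ℝ) p.2) := by
    have hs : MeasurableSet {p : (Eucl n × Eucl n) × ℝ | p.2 ∈ Set.uIoc (w p.1.1) (w p.1.2)} := by
      simp only [Set.uIoc, Set.mem_Ioc]
      measurability
    exact measurable_one.indicator hs
  have h1 := key hu
  have h2 := key hv
  unfold Function.uncurry coareaIntegrand
  refine Measurable.div (h1.sub h2) (by fun_prop)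

/-- Integrating in t first gives two bounds: the sum of the energy densities of u and v, or |u - v|
at both points times the kernel. The second handles pairs across the boundary by Hardy for u - v. -/
lemma integrable_coareaIntegrand (hs0 : 0 < s) (hs1 : s < 1)
    (hΩo : IsOpen Ω) (hΩb : Bornology.IsBounded Ω) (hΩ : HasLipschitzBoundary Ω)
    (hum : Measurable u) (hvm : Measurable v) (hu : u ∈ SobolevW s Ω) (hv : v ∈ SobolevW s Ω)
    (huv : ∀ᵐ x : Eucl n, x ∉ Ω → u x = v x) :
    Integrable (Function.uncurry (coareaIntegrand s u v)) ((volume.restrict (Q Ω)).prod volume) := by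
  have hm := measurable_coareaIntegrand (s := s) hum hvm
  refine ⟨hm.aestronglyMeasurable, ?_⟩
  rw [HasFiniteIntegral, lintegral_prod _ hm.enorm.aemeasurable]
  simp only [Function.uncurry, coareaIntegrand, enorm_div_norm_rpow]
  have hbound (a b c d : ℝ) {F : ℝ → ℝ} (k : ℝ≥0∞) (hk : k ≠ ∞)
      (h : ∀ t, |F t| ≤ |(Set.uIoc a b).indicator (1 : ℝ → ℝ) t| +
        |(Set.uIoc c d).indicator (1 : ℝ → ℝ) t|) :
      ∫⁻ t, ‖F t‖ₑ * k ≤ (‖a - b‖ₑ + ‖c - d‖ₑ) * k := by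
    rw [lintegral_mul_const' _ _ hk, ← lintegral_enorm_indicator_uIoc,
      ← lintegral_enorm_indicator_uIoc, ← lintegral_add_left]
    · gcongr with t
      exact enorm_le_add_of_abs_le (h t)
    · exact (measurable_one.indicator measurableSet_uIoc).enorm
  refine setLIntegral_Q_lt_top hs0 hs1 hΩo hΩb hΩ hu hv huv (fun z => ?_) (fun z => ?_)
  · rw [energyDensity, energyDensity, ← add_mul]
    exact hbound _ _ _ _ _ ENNReal.ofReal_ne_top fun t => abs_sub _ _
  · exact hbound _ _ _ _ _ ENNReal.ofReal_ne_top fun t => abs_indicator_uIoc_sub_le _ _ _ _ _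

/-- If almost every superlevel set of `u` has finite perimeter, not larger than that of the
corresponding superlevel set of `v`, then `u` has not more energy than `v`. -/
lemma energy_difference_nonpos (hs0 : 0 < s) (hs1 : s < 1)
    (hΩo : IsOpen Ω) (hΩb : Bornology.IsBounded Ω) (hΩ : HasLipschitzBoundary Ω)
    (hum : Measurable u) (hvm : Measurable v) (hu : u ∈ SobolevW s Ω) (hv : v ∈ SobolevW s Ω)
    (huv : ∀ᵐ x : Eucl n, x ∉ Ω → u x = v x)
    (hper : ∀ᵐ t : ℝ, fracPer s {x | t ≤ u x} Ω < ∞ ∧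
      fracPer s {x | t ≤ u x} Ω ≤ fracPer s {x | t ≤ v x} Ω) :
    IntegrableOn (fun z : Eucl n × Eucl n => (|u z.1 - u z.2| - |v z.1 - v z.2|) /
        ‖z.1 - z.2‖ ^ ((n : ℝ) + s)) (Q Ω) volume ∧
      ∫ z in Q Ω, (|u z.1 - u z.2| - |v z.1 - v z.2|) / ‖z.1 - z.2‖ ^ ((n : ℝ) + s) ≤ 0 := by
  have hint := integrable_coareaIntegrand hs0 hs1 hΩo hΩb hΩ hum hvm hu hv huv
  simp_rw [← integral_coareaIntegrand]
  refine ⟨hint.integral_prod_left, ?_⟩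
  rw [integral_integral_swap hint]
  refine integral_nonpos_of_ae ?_
  filter_upwards [hper] with t ht
  simp_rw [coareaIntegrand_eq]
  have hm {w : Eucl n → ℝ} (hw : Measurable w) :
      AEMeasurable ({x | t ≤ w x}.indicator (1 : Eucl n → ℝ)) volume :=
    (measurable_one.indicator (measurableSet_le measurable_const hw)).aemeasurable
  refine integral_sub_nonpos_of_lintegral_le (aemeasurable_gagliardoQuotient (hm hum)).restrict
    (aemeasurable_gagliardoQuotient (hm hvm)).restrict (fun _ => gagliardoQuotient_nonneg _ _ _ _)
    (fun _ => gagliardoQuotient_nonneg _ _ _ _) ?_ ?_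
  · simp_rw [ofReal_gagliardoQuotient]
    exact fracPer_lt_top_iff.1 ht.1
  · simp_rw [ofReal_gagliardoQuotient]
    exact fracPer_le_fracPer_iff.1 ht.2

/-- A function of `𝒲^s(Ω)` whose superlevel sets are almost all `s`-minimal is `s`-minimal. -/
theorem isSMinimalFunction_of_ae_isSMinimalSet (hs0 : 0 < s) (hs1 : s < 1)
    (hΩo : IsOpen Ω) (hΩb : Bornology.IsBounded Ω) (hΩ : HasLipschitzBoundary Ω)
    (hu : u ∈ SobolevW s Ω) (hmin : ∀ᵐ t : ℝ, IsSMinimalSet s Ω {x | t ≤ u x}) :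
    IsSMinimalFunction s Ω u := by
  refine ⟨hu, fun v hv huv => ?_⟩
  have hu' := hu.1.ae_eq_mk
  have hv' := hv.1.ae_eq_mk
  have hum := hu.1.measurable_mk
  have hvm := hv.1.measurable_mk
  set u' := hu.1.mk u
  set v' := hv.1.mk v
  have huv' : ∀ᵐ x : Eucl n, x ∉ Ω → u' x = v' x := by
    filter_upwards [hu', hv', huv] with x h1 h2 h3 h4
    rw [← h1, ← h2, h3 h4]
  have hlevel {w w' : Eucl n → ℝ} (h : w =ᵐ[volume] w') (t : ℝ) :
      ({x | t ≤ w x} : Set (Eucl n)) =ᵐ[volume] {x | t ≤ w' x} := by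
    refine eventuallyEq_set.2 ?_
    filter_upwards [h] with x hx
    simp only [hx]
  have hmain := energy_difference_nonpos hs0 hs1 hΩo hΩb hΩ hum hvm (SobolevW_congr_ae hu hu')
    (SobolevW_congr_ae hv hv') huv' (by
      filter_upwards [hmin] with t ht
      rw [← fracPer_congr_ae (hlevel hu' t)]
      refine ⟨ht.2.1, ?_⟩
      -- A competitor set must agree with {t ≤ u} everywhere off Ω, whereas v' does so only almost
      -- everywhere; hence the gluing.
      set G : Set (Eucl n) := {x | t ≤ v' x} ∩ Ω ∪ {x | t ≤ u x} \ Ω with hG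
      have hGm : NullMeasurableSet G volume :=
        ((measurableSet_le measurable_const hvm).nullMeasurableSet.inter
          hΩo.measurableSet.nullMeasurableSet).union
          (ht.1.diff hΩo.measurableSet.nullMeasurableSet)
      have hGE : G \ Ω = {x | t ≤ u x} \ Ω := by
        ext x
        simp only [hG, Set.mem_sdiff, Set.mem_union, Set.mem_inter_iff]
        tauto
      have hGv : G =ᵐ[volume] {x | t ≤ v' x} := by
        refine eventuallyEq_set.2 ?_
        filter_upwards [hv', huv, hu'] with x h1 h2 h3
        simp only [hG, Set.mem_union, Set.mem_inter_iff, Set.mem_sdiff, Set.mem_ofPred_eq]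
        by_cases hx : x ∈ Ω
        · simp [hx]
        · simp [hx, h2 hx, h1]
      rw [← fracPer_congr_ae hGv]
      exact ht.2.2 G hGm hGE)
  have hcongr : (fun z : Eucl n × Eucl n => (|u z.1 - u z.2| - |v z.1 - v z.2|) /
        ‖z.1 - z.2‖ ^ ((n : ℝ) + s)) =ᵐ[volume.restrict (Q Ω)]
      fun z => (|u' z.1 - u' z.2| - |v' z.1 - v' z.2|) / ‖z.1 - z.2‖ ^ ((n : ℝ) + s) := by
    refine ae_restrict_of_ae ?_
    filter_upwards [ae_prod_and hu', ae_prod_and hv'] with z h1 h2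
    rw [h1.1, h1.2, h2.1, h2.2]
  exact ⟨hmain.1.congr hcongr.symm, (integral_congr_ae hcongr).trans_le hmain.2⟩

end Coarea

/-! ### Cut-off functions -/

/-- The piecewise linear cut-off which is `0` below `t - ε` and `1` above `t`. -/
noncomputable def ramp (t ε a : ℝ) : ℝ := max 0 (min 1 ((a - t) / ε + 1))

section Ramp

variable {t ε : ℝ}

lemma ramp_nonneg (a : ℝ) : 0 ≤ ramp t ε a := le_max_left _ _

lemma ramp_le_one (a : ℝ) : ramp t ε a ≤ 1 := max_le zero_le_one (min_le_left _ _)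

/-- The slope of the ramp lies between 0 and 1/ε, so both ε · ramp and the identity minus ε · ramp
are nondecreasing. -/
lemma ramp_sub_bounds (hε : 0 < ε) {a b : ℝ} (h : b ≤ a) :
    0 ≤ ε * (ramp t ε a - ramp t ε b) ∧ ε * (ramp t ε a - ramp t ε b) ≤ a - b := by
  have h1 : ε * ((a - t) / ε + 1 - ((b - t) / ε + 1)) = a - b := by field_simp; ring
  have h2 : (b - t) / ε ≤ (a - t) / ε := by gcongr
  have hmono : ramp t ε b ≤ ramp t ε a := by unfold ramp; gcongr
  refine ⟨mul_nonneg hε.le (sub_nonneg.2 hmono), ?_⟩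
  rw [← h1]
  refine mul_le_mul_of_nonneg_left ?_ hε.le
  unfold ramp
  rcases max_cases 0 (min 1 ((a - t) / ε + 1)) with h3 | h3 <;>
  rcases max_cases 0 (min 1 ((b - t) / ε + 1)) with h4 | h4 <;>
  rcases min_cases 1 ((a - t) / ε + 1) with h5 | h5 <;>
  rcases min_cases 1 ((b - t) / ε + 1) with h6 | h6 <;> linarith

/-- The cut-off splits the oscillation of a function into two monotone parts. -/
lemma abs_sub_ramp (hε : 0 < ε) (a b : ℝ) :
    |a - b| = |a - ε * ramp t ε a - (b - ε * ramp t ε b)| + ε * |ramp t ε a - ramp t ε b| := by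
  wlog h : b ≤ a generalizing a b
  · rw [abs_sub_comm a b, this b a (not_le.1 h).le, abs_sub_comm (ramp t ε a),
      abs_sub_comm (a - _)]
  obtain ⟨h1, h2⟩ := ramp_sub_bounds (t := t) hε h
  have h3 : 0 ≤ ramp t ε a - ramp t ε b := nonneg_of_mul_nonneg_right h1 hε
  rw [abs_of_nonneg (sub_nonneg.2 h), abs_of_nonneg h3, abs_of_nonneg (by linarith)]
  ring

lemma continuous_ramp : Continuous (ramp t ε) := by unfold ramp; fun_prop

lemma abs_ramp_sub_le_one (a b : ℝ) : |ramp t ε a - ramp t ε b| ≤ 1 := by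
  rw [abs_le]
  constructor <;> linarith [ramp_nonneg (t := t) (ε := ε) a, ramp_nonneg (t := t) (ε := ε) b,
    ramp_le_one (t := t) (ε := ε) a, ramp_le_one (t := t) (ε := ε) b]

/-- The ramp lies to the left of t and is already 1 at t, so the limit is the indicator of the
closed condition t ≤ u. -/
lemma ramp_tendsto {α : Type*} (u : α → ℝ) (x : α) :
    Tendsto (fun k : ℕ => ramp t (1 / ((k : ℝ) + 1)) (u x)) atTop
      (𝓝 ({x | t ≤ u x}.indicator (1 : α → ℝ) x)) := by
  by_cases hx : t ≤ u x
  · rw [Set.indicator_of_mem (by exact hx)]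
    refine tendsto_const_nhds.congr fun k => ?_
    have : 0 ≤ (u x - t) / (1 / ((k : ℝ) + 1)) := div_nonneg (sub_nonneg.2 hx) (by positivity)
    rw [ramp, min_eq_left (by linarith), max_eq_right zero_le_one, Pi.one_apply]
  · rw [Set.indicator_of_notMem (by exact hx)]
    have hpos : 0 < t - u x := by linarith
    refine tendsto_const_nhds.congr' ?_
    filter_upwards [(tendsto_one_div_add_atTop_nhds_zero_nat (𝕜 := ℝ)).eventually_lt_const hpos]
      with k hk
    have hk0 : (0 : ℝ) < 1 / ((k : ℝ) + 1) := by positivity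
    have : (u x - t) / (1 / ((k : ℝ) + 1)) ≤ -1 := by
      rw [div_le_iff₀ hk0]; linarith
    rw [ramp, max_eq_left]
    exact (min_le_right _ _).trans (by linarith)

end Ramp

/-! ### From minimal functions to minimal sets -/

section Minimal

variable {n : ℕ} {s : ℝ} {Ω : Set (Eucl n)}

/-- Off Ω × Ω the bound is Hardy for the constant 1: the kernel has finite mass on Ω × 𝒞Ω. -/
lemma setLIntegral_Q_lt_top_of_le_kernel (hs0 : 0 < s) (hs1 : s < 1)
    (hΩo : IsOpen Ω) (hΩb : Bornology.IsBounded Ω) (hΩ : HasLipschitzBoundary Ω)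
    {f g : Eucl n × Eucl n → ℝ≥0∞} (hg : ∫⁻ z in Ω ×ˢ Ω, g z < ∞)
    (hf1 : ∀ z ∈ Ω ×ˢ Ω, f z ≤ g z) (hf2 : ∀ z ∉ Ω ×ˢ Ω, f z ≤ kernel s (z.1 - z.2)) :
    ∫⁻ z in Q Ω, f z < ∞ := by
  have hΩm := hΩo.measurableSet
  have h1 := const_mem_SobolevW (s := s) hΩb 1
  refine (setLIntegral_Q_le f).trans_lt (ENNReal.add_lt_top.2 ⟨?_, ENNReal.add_lt_top.2 ⟨?_, ?_⟩⟩)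
  · exact (setLIntegral_mono' (hΩm.prod hΩm) hf1).trans_lt hg
  · refine (setLIntegral_mono' (hΩm.prod hΩm.compl) fun z hz => ?_).trans_lt
      (setLIntegral_fst_mul_kernel_lt_top hs0 hs1 hΩo hΩb hΩ h1)
    rw [enorm_one, one_mul]
    exact hf2 z fun h => hz.2 h.2
  · refine (setLIntegral_mono' (hΩm.compl.prod hΩm) fun z hz => ?_).trans_lt
      (setLIntegral_snd_mul_kernel_lt_top hs0 hs1 hΩo hΩb hΩ h1)
    rw [enorm_one, one_mul]
    exact hf2 z fun h => hz.1 h.1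

lemma energyDensity_le_kernel {v : Eucl n → ℝ} {z : Eucl n × Eucl n} (h : |v z.1 - v z.2| ≤ 1) :
    energyDensity s v z ≤ kernel s (z.1 - z.2) := by
  refine mul_le_of_le_one_left' ?_
  rw [Real.enorm_eq_ofReal_abs, ← ENNReal.ofReal_one]
  exact ENNReal.ofReal_le_ofReal h

lemma integrableOn_gagliardoQuotient {w : Eucl n → ℝ} (hw : AEMeasurable w volume)
    (hwi : ∫⁻ z in Q Ω, energyDensity s w z < ∞) :
    IntegrableOn (fun z : Eucl n × Eucl n => gagliardoQuotient s w z.1 z.2) (Q Ω) volume := by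
  refine ⟨(aemeasurable_gagliardoQuotient hw).aestronglyMeasurable.restrict, ?_⟩
  rw [hasFiniteIntegral_iff_ofReal
    (ae_of_all _ fun z : Eucl n × Eucl n => gagliardoQuotient_nonneg s w z.1 z.2)]
  simpa only [ofReal_gagliardoQuotient] using hwi

lemma lintegral_energyDensity_eq {w : Eucl n → ℝ} (hw : AEMeasurable w volume)
    (hwi : ∫⁻ z in Q Ω, energyDensity s w z < ∞) :
    ∫⁻ z in Q Ω, energyDensity s w z =
      ENNReal.ofReal (∫ z in Q Ω, gagliardoQuotient s w z.1 z.2) := by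
  rw [ofReal_integral_eq_lintegral_ofReal (integrableOn_gagliardoQuotient hw hwi)
    (ae_of_all _ fun z : Eucl n × Eucl n => gagliardoQuotient_nonneg s w z.1 z.2)]
  simp_rw [ofReal_gagliardoQuotient]

open scoped Classical in
lemma aemeasurable_piecewise {f g : Eucl n → ℝ} {A : Set (Eucl n)} (hA : MeasurableSet A)
    (hf : AEMeasurable f volume) (hg : AEMeasurable g volume) :
    AEMeasurable (A.piecewise f g) volume := by
  rw [show A.piecewise f g = A.indicator f + Aᶜ.indicator g by
    ext x; by_cases hx : x ∈ A <;> simp [hx]]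
  exact (hf.indicator hA).add (hg.indicator hA.compl)

open scoped Classical in
/-- The cut-off of a minimal function has at most the energy of the function obtained by replacing
it in `Ω` by a characteristic function. -/
lemma IsSMinimalFunction.energy_ramp_le (hs0 : 0 < s) (hs1 : s < 1)
    (hΩo : IsOpen Ω) (hΩb : Bornology.IsBounded Ω) (hΩ : HasLipschitzBoundary Ω)
    {u : Eucl n → ℝ} (hu : IsSMinimalFunction s Ω u) {F : Set (Eucl n)}
    (hF : NullMeasurableSet F volume)
    (hFfin : ∫⁻ z in Ω ×ˢ Ω, energyDensity s (F.indicator 1) z < ∞) (t : ℝ) {ε : ℝ} (hε : 0 < ε)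
    (hε1 : ε ≤ 1) :
    ∫⁻ z in Q Ω, energyDensity s (fun x => ramp t ε (u x)) z ≤
      ∫⁻ z in Q Ω, energyDensity s
        (Ω.piecewise (F.indicator 1) (fun x => ramp t ε (u x))) z := by
  have hΩm := hΩo.measurableSet
  have huW := mem_SobolevW_iff.1 hu.1
  set w : Eucl n → ℝ := fun x => ramp t ε (u x) with hw
  set v : Eucl n → ℝ := Ω.piecewise (F.indicator 1) w with hv
  have hχm : AEMeasurable (F.indicator (1 : Eucl n → ℝ)) volume := aemeasurable_one.indicator₀ hF
  have hwm : AEMeasurable w volume := continuous_ramp.measurable.comp_aemeasurable huW.1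
  have hvm : AEMeasurable v volume := aemeasurable_piecewise hΩm hχm hwm
  have hv01 (x : Eucl n) : 0 ≤ v x ∧ v x ≤ 1 := by
    by_cases hx : x ∈ Ω
    · rw [hv, Set.piecewise_eq_of_mem _ _ _ hx]
      by_cases hxF : x ∈ F <;> simp [hxF]
    · rw [hv, Set.piecewise_eq_of_notMem _ _ _ hx]
      exact ⟨ramp_nonneg _, ramp_le_one _⟩
  have hvΩ {x : Eucl n} (hx : x ∈ Ω) : v x = F.indicator 1 x := Set.piecewise_eq_of_mem _ _ _ hx
  have hsplit (x y : Eucl n) : |u x - u y| = |u x - ε * w x - (u y - ε * w y)| +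
      ε * |w x - w y| := abs_sub_ramp hε _ _
  have hbdd {f : Eucl n → ℝ} (hf : AEMeasurable f volume) (hf01 : ∀ x, 0 ≤ f x ∧ f x ≤ 1) :
      IntegrableOn f Ω volume := by
    refine Measure.integrableOn_of_bounded (M := 1) hΩb.measure_lt_top.ne hf.aestronglyMeasurable
      (ae_of_all _ fun x => ?_)
    rw [Real.norm_of_nonneg (hf01 x).1]
    exact (hf01 x).2
  -- The competitor swaps the layer εw of u for εv; it equals u off Ω since v = w there.
  set z : Eucl n → ℝ := fun x => u x - ε * w x + ε * v x with hz
  have hzle (x y : Eucl n) :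
      |z x - z y| ≤ |u x - ε * w x - (u y - ε * w y)| + ε * |v x - v y| := by
    calc |z x - z y| = |(u x - ε * w x - (u y - ε * w y)) + ε * (v x - v y)| := by
          simp only [hz]; congr 1; ring
      _ ≤ |u x - ε * w x - (u y - ε * w y)| + |ε * (v x - v y)| := abs_add_le _ _
      _ = _ := by rw [abs_mul, abs_of_pos hε]
  have hzW : z ∈ SobolevW s Ω := by
    refine mem_SobolevW_of_abs_sub_le hΩm huW.1 huW.2.2 hFfin
      ((huW.1.sub (hwm.const_mul ε)).add (hvm.const_mul ε)) ?_ ?_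
    · exact (huW.2.1.sub ((hbdd hwm fun x => ⟨ramp_nonneg _, ramp_le_one _⟩).const_mul ε)).add
        ((hbdd hvm hv01).const_mul ε)
    · intro x hx y hy
      rw [← hvΩ hx, ← hvΩ hy, hsplit]
      have := hzle x y
      have := mul_le_of_le_one_left (abs_nonneg (v x - v y)) hε1
      have := mul_nonneg hε.le (abs_nonneg (w x - w y))
      linarith
  obtain ⟨hint, hle⟩ := hu.2 z hzW (ae_of_all _ fun x hx => by
    simp only [hz, hv, Set.piecewise_eq_of_notMem _ _ _ hx]; ring)
  have hw_fin : ∫⁻ z in Q Ω, energyDensity s w z < ∞ := by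
    refine setLIntegral_Q_lt_top_of_le_kernel hs0 hs1 hΩo hΩb hΩ
      (g := fun z => ENNReal.ofReal ε⁻¹ * energyDensity s u z) ?_ (fun z _ => ?_)
      fun z _ => energyDensity_le_kernel (abs_ramp_sub_le_one _ _)
    · rw [lintegral_const_mul' _ _ ENNReal.ofReal_ne_top]
      exact ENNReal.mul_lt_top ENNReal.ofReal_lt_top huW.2.2
    · rw [energyDensity, energyDensity, ← mul_assoc]
      gcongr
      rw [Real.enorm_eq_ofReal_abs, Real.enorm_eq_ofReal_abs, ← ENNReal.ofReal_mul (by positivity)]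
      apply ENNReal.ofReal_le_ofReal
      rw [inv_mul_eq_div, le_div_iff₀' hε, hsplit z.1 z.2]
      exact le_add_of_nonneg_left (abs_nonneg _)
  have hv_fin : ∫⁻ z in Q Ω, energyDensity s v z < ∞ := by
    refine setLIntegral_Q_lt_top_of_le_kernel hs0 hs1 hΩo hΩb hΩ hFfin (fun z hz => ?_)
      fun z _ => energyDensity_le_kernel ?_
    · rw [energyDensity, energyDensity, hvΩ hz.1, hvΩ hz.2]
    · rw [abs_le]
      constructor <;> linarith [hv01 z.1, hv01 z.2]
  have hwi := integrableOn_gagliardoQuotient hwm hw_fin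
  have hvi := integrableOn_gagliardoQuotient hvm hv_fin
  -- By `hsplit` and `hzle` the oscillations of u - εw cancel, leaving ε times the energy difference
  -- of w and v.
  have hmono : ∫ p in Q Ω, ε * (gagliardoQuotient s w p.1 p.2 - gagliardoQuotient s v p.1 p.2) ≤
      ∫ p in Q Ω, (|u p.1 - u p.2| - |z p.1 - z p.2|) / ‖p.1 - p.2‖ ^ ((n : ℝ) + s) := by
    refine integral_mono ((hwi.sub hvi).const_mul ε) hint fun p => ?_
    simp only [gagliardoQuotient]
    rw [← sub_div, ← mul_div_assoc]
    gcongr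
    linarith [hsplit p.1 p.2, hzle p.1 p.2]
  rw [integral_const_mul, integral_sub hwi hvi] at hmono
  rw [lintegral_energyDensity_eq hwm hw_fin, lintegral_energyDensity_eq hvm hv_fin]
  refine ENNReal.ofReal_le_ofReal (sub_nonpos.1 ?_)
  exact nonpos_of_mul_nonpos_right (hmono.trans hle) hε

open scoped Classical in
/-- The superlevel sets of an `s`-minimal function are `s`-minimal. -/
theorem IsSMinimalFunction.isSMinimalSet (hs0 : 0 < s) (hs1 : s < 1)
    (hΩo : IsOpen Ω) (hΩb : Bornology.IsBounded Ω) (hΩ : HasLipschitzBoundary Ω)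
    {u : Eucl n → ℝ} (hu : IsSMinimalFunction s Ω u) (t : ℝ) :
    IsSMinimalSet s Ω {x | t ≤ u x} := by
  have hΩm := hΩo.measurableSet
  have huW := mem_SobolevW_iff.1 hu.1
  set E : Set (Eucl n) := {x | t ≤ u x} with hE
  have hEm : NullMeasurableSet E volume := nullMeasurableSet_le aemeasurable_const huW.1
  have hχ01 (G : Set (Eucl n)) (x : Eucl n) :
      0 ≤ G.indicator (1 : Eucl n → ℝ) x ∧ G.indicator (1 : Eucl n → ℝ) x ≤ 1 := by
    by_cases hx : x ∈ G <;> simp [hx]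
  have hmin : ∀ F : Set (Eucl n), NullMeasurableSet F volume → F \ Ω = E \ Ω →
      fracPer s E Ω ≤ fracPer s F Ω := by
    intro F hF hFE
    rw [fracPer_le_fracPer_iff]
    by_cases hfin : ∫⁻ z in Q Ω, energyDensity s (F.indicator 1) z = ∞
    · rw [hfin]; exact le_top
    have hFfin : ∫⁻ z in Ω ×ˢ Ω, energyDensity s (F.indicator 1) z < ∞ :=
      (lintegral_mono_set fun z hz => fun h => h.1 hz.1).trans_lt (lt_top_iff_ne_top.2 hfin)
    have hχF : AEMeasurable (F.indicator (1 : Eucl n → ℝ)) volume := aemeasurable_one.indicator₀ hF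
    set w : ℕ → Eucl n → ℝ := fun k x => ramp t (1 / ((k : ℝ) + 1)) (u x) with hw
    set v : ℕ → Eucl n → ℝ := fun k => Ω.piecewise (F.indicator 1) (w k) with hv
    have hwm (k : ℕ) : AEMeasurable (w k) volume :=
      continuous_ramp.measurable.comp_aemeasurable huW.1
    have hvm (k : ℕ) : AEMeasurable (v k) volume := aemeasurable_piecewise hΩm hχF (hwm k)
    have hv01 (k : ℕ) (x : Eucl n) : 0 ≤ v k x ∧ v k x ≤ 1 := by
      by_cases hx : x ∈ Ω
      · simp only [hv, Set.piecewise_eq_of_mem _ _ _ hx]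
        exact hχ01 F x
      · simp only [hv, Set.piecewise_eq_of_notMem _ _ _ hx]
        exact ⟨ramp_nonneg _, ramp_le_one _⟩
    have hlimw (x : Eucl n) : Tendsto (fun k => w k x) atTop (𝓝 (E.indicator 1 x)) :=
      ramp_tendsto u x
    have hlimv (x : Eucl n) : Tendsto (fun k => v k x) atTop (𝓝 (F.indicator 1 x)) := by
      by_cases hx : x ∈ Ω
      · simp only [hv, Set.piecewise_eq_of_mem _ _ _ hx]
        exact tendsto_const_nhds
      · have hmem : x ∈ F ↔ x ∈ E := by
          have := Set.ext_iff.1 hFE x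
          simpa [hx] using this
        have : F.indicator (1 : Eucl n → ℝ) x = E.indicator 1 x := by
          simp only [Set.indicator_apply, hmem]
        simp only [hv, Set.piecewise_eq_of_notMem _ _ _ hx, this]
        exact hlimw x
    have hlim {f : ℕ → Eucl n → ℝ} {g : Eucl n → ℝ}
        (h : ∀ x, Tendsto (fun k => f k x) atTop (𝓝 (g x))) (z : Eucl n × Eucl n) :
        Tendsto (fun k => energyDensity s (f k) z) atTop (𝓝 (energyDensity s g z)) :=
      ENNReal.Tendsto.mul_const (((h z.1).sub (h z.2)).enorm) (Or.inr ENNReal.ofReal_ne_top)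
    have hle (k : ℕ) : ∫⁻ z in Q Ω, energyDensity s (w k) z ≤
        ∫⁻ z in Q Ω, energyDensity s (v k) z :=
      hu.energy_ramp_le hs0 hs1 hΩo hΩb hΩ hF hFfin t (by positivity) (by
        rw [div_le_one (by positivity)]; linarith [Nat.cast_nonneg (α := ℝ) k])
    -- In Ω × Ω the energy density of v k does not depend on k; elsewhere v k has oscillation at
    -- most 1.
    set bound : Eucl n × Eucl n → ℝ≥0∞ :=
      (Ω ×ˢ Ω).piecewise (energyDensity s (F.indicator 1)) (fun z => kernel s (z.1 - z.2))
      with hbound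
    have hbound_fin : ∫⁻ z in Q Ω, bound z < ∞ :=
      setLIntegral_Q_lt_top_of_le_kernel hs0 hs1 hΩo hΩb hΩ hFfin
        (fun z hz => (Set.piecewise_eq_of_mem _ _ _ hz).le)
        fun z hz => (Set.piecewise_eq_of_notMem _ _ _ hz).le
    have hdom (k : ℕ) (z : Eucl n × Eucl n) : energyDensity s (v k) z ≤ bound z := by
      by_cases hz : z ∈ Ω ×ˢ Ω
      · rw [hbound, Set.piecewise_eq_of_mem _ _ _ hz, energyDensity, energyDensity]
        simp only [hv, Set.piecewise_eq_of_mem _ _ _ hz.1, Set.piecewise_eq_of_mem _ _ _ hz.2]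
        exact le_rfl
      · rw [hbound, Set.piecewise_eq_of_notMem _ _ _ hz]
        refine energyDensity_le_kernel ?_
        rw [abs_le]
        constructor <;> linarith [hv01 k z.1, hv01 k z.2]
    have hconv : Tendsto (fun k => ∫⁻ z in Q Ω, energyDensity s (v k) z) atTop
        (𝓝 (∫⁻ z in Q Ω, energyDensity s (F.indicator 1) z)) :=
      tendsto_lintegral_of_dominated_convergence' bound
        (fun k => (aemeasurable_energyDensity (hvm k)).restrict)
        (fun k => ae_of_all _ (hdom k)) hbound_fin.ne (ae_of_all _ (hlim hlimv))
    calc ∫⁻ z in Q Ω, energyDensity s (E.indicator 1) z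
        = ∫⁻ z in Q Ω, liminf (fun k => energyDensity s (w k) z) atTop :=
          lintegral_congr fun z => (hlim hlimw z).liminf_eq.symm
      _ ≤ liminf (fun k => ∫⁻ z in Q Ω, energyDensity s (w k) z) atTop :=
          lintegral_liminf_le' fun k => (aemeasurable_energyDensity (hwm k)).restrict
      _ ≤ liminf (fun k => ∫⁻ z in Q Ω, energyDensity s (v k) z) atTop :=
          liminf_le_liminf (Eventually.of_forall hle)
      _ = _ := hconv.liminf_eq
  refine ⟨hEm, ?_, hmin⟩
  -- Finite perimeter follows by comparison with E \ Ω, whose indicator vanishes in Ω, so that only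
  -- interactions across the boundary remain.
  refine (hmin (E \ Ω) (hEm.diff hΩm.nullMeasurableSet) (by simp)).trans_lt ?_
  rw [fracPer_lt_top_iff]
  refine setLIntegral_Q_lt_top_of_le_kernel hs0 hs1 hΩo hΩb hΩ (g := 0) (by simp) (fun z hz => ?_)
    fun z _ => energyDensity_le_kernel ?_
  · simp [energyDensity, hz.1, hz.2]
  · rw [abs_le]
    constructor <;> linarith [hχ01 (E \ Ω) z.1, hχ01 (E \ Ω) z.2]

end Minimal

end FractionalMinimal

theorem mainTheorem1 {n : ℕ} (hn : 1 ≤ n) {s : ℝ} (hs0 : 0 < s) (hs1 : s < 1)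
    {Ω : Set (FractionalMinimal.Eucl n)} (hΩ_open : IsOpen Ω)
    (hΩ_bdd : Bornology.IsBounded Ω)
    (hΩ_lip : FractionalMinimal.HasLipschitzBoundary Ω)
    {u : FractionalMinimal.Eucl n → ℝ} (hu : u ∈ FractionalMinimal.SobolevW s Ω) :
    (FractionalMinimal.IsSMinimalFunction s Ω u →
      ∀ t : ℝ, FractionalMinimal.IsSMinimalSet s Ω {x | t ≤ u x}) ∧
    ((∀ᵐ t : ℝ, FractionalMinimal.IsSMinimalSet s Ω {x | t ≤ u x}) →
      FractionalMinimal.IsSMinimalFunction s Ω u) := by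
  exact ⟨fun h t => h.isSMinimalSet hs0 hs1 hΩ_open hΩ_bdd hΩ_lip t,
    fun h => FractionalMinimal.isSMinimalFunction_of_ae_isSMinimalSet hs0 hs1 hΩ_open hΩ_bdd
      hΩ_lip hu h⟩
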